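/- Notation. Let $d$ be a positive integer and let $P(d)$ be the number of partitions of $d$. For a field $k$ of characteristic $0$ let $R_n=k[x_1,\dots,x_n]$, on which $\mathfrak S_n$ acts by permuting the variables, let $\rho_n(f)=\frac1{n!}\sum_{\sigma\in\mathfrak S_n}\sigma\cdot f$, and for a set $F\subseteq R_n$ let $(F)_{\mathfrak S_n}$ be the ideal generated by all $\sigma\cdot f$ with $f\in F$, $\sigma\in\mathfrak S_n$. For $n\ge d$ the space $[R_n']_d$ of symmetric forms of degree $d$ is identified with $k^{P(d)}$ through the basis $M_\lambda=\rho_n(x_1^{\lambda_1}x_2^{\lambda_2}\cdots)$, $\lambda\vdash d$. Let $S_n=k[y_1,\dots,y_n]_{DP}$ be the divided power algebra with $\deg y_i=-1$, on which $R_n$ acts by contraction $\circ$, and let $[S_n']_{-d}$ be the space of its $\mathfrak S_n$-invariant elements of degree $-d$. Fix $1\le r\le P(d)$. For $U\in \mathrm{Gr}(r,k^{P(d)})=\mathrm{Gr}(r,[R'_n]_d)$ and $V\in\mathrm{Gr}(r,[R_n]_d)$ put $$U^\perp=\{w\in [S_n']_{-d}: u\circ w=0\ \ \forall u\in U\},\qquad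 \Psi_n(U)=\operatorname{Ann}_{R_n}\bigl(U^\perp+(S_n)_{\ge -d+1}\bigr),$$ $$\Phi_n(V)=(V)_{\mathfrak S_n},\qquad \alpha_n(V)=\rho_n(V)\subseteq [R_n']_d=k^{P(d)} .$$ Call $G\subseteq \mathrm{Gr}(r,k^{P(d)})$ a parameter set if it is nonempty and Zariski open and if for all $n>d$ and all $U\in G$ the ideal $\Psi_n(U)$ is generated in degree $d$. Given $G$, let $\widetilde O_n$ be the set of all $V\in\mathrm{Gr}(r,[R_n]_d)$ with $\dim_k[(V)_{\mathfrak S_n}]_d\ge\dim_k[R_n]_d-(P(d)-r)$, let $O_n=\widetilde O_n\cap\alpha_n^{-1}(G)$ if $r<P(d)$ and $O_n=\widetilde O_n$ if $r=P(d)$, and let $\mathcal{SI}^g(R_n)=\{(V)_{\mathfrak S_n}:V\in O_n\}$ be the set of general $(r,d)$-symmetric ideals of $R_n$. For $m\le n$ let $\pi_{m,n}(V)\subseteq R_n$ be the subspace $V\subseteq R_m$ regarded in $R_n$, and let $\eta_{m,n}(I)=(I)_{\mathfrak S_n}$ for an ideal $I$ of $R_m$. Theorem. For every positive integer $d$ there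 is an integer $m_0$, depending only on $d$, such that the following holds for every field $k$ of characteristic $0$ and every $1\le r\le P(d)$. Parameter sets exist; and for every parameter set $G$ and all $n\ge m\ge m_0$: 1. $\eta_{m,n}$ restricts to a bijection $\mathcal{SI}^g(R_m)\to\mathcal{SI}^g(R_n)$; in particular, if $I$ is a general $(r,d)$-symmetric ideal of $R_m$, then $(I)_{\mathfrak S_n}$ is a general $(r,d)$-symmetric ideal of $R_n$. 2. $\pi_{m,n}(O_m)\subseteq O_n$. 3. $\alpha_m(O_m)\subseteq G$, $\alpha_n(O_n)\subseteq G$, and the maps are compatible: $\alpha_n\circ\pi_{m,n}=\alpha_m$ and $\eta_{m,n}\circ\Phi_m=\Phi_n\circ\pi_{m,n}$ on $O_m$; $\Psi_m\circ\alpha_m=\Phi_m$ on $O_m$ and $\Psi_n\circ\alpha_n=\Phi_n$ on $O_n$; $\eta_{m,n}\circ\Psi_m=\Psi_n$ on $G$. Moreover $\Psi_m\colon G\to\mathcal{SI}^g(R_m)$ and $\Psi_n\colon G\to\mathcal{SI}^g(R_n)$ are bijections. -/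

import Mathlib

open MvPolynomial

noncomputable section

namespace SymIdeal

universe u

variable (k : Type u) [Field k]

/-! ### The polynomial ring `R_n = k[x_1, …, x_n]` with its action of the symmetric group -/

/-- The degree `d` component `R_d` of `R = k[x_1, …, x_n]`. -/
abbrev degPart (n d : ℕ) : Submodule k (MvPolynomial (Fin n) k) :=
  homogeneousSubmodule (Fin n) k d

/-- The degree `d` component `I_d` of an ideal `I` of `R`. -/
def idealDegPart {n : ℕ} (I : Ideal (MvPolynomial (Fin n) k)) (d : ℕ) :
    Submodule k (MvPolynomial (Fin n) k) :=
  I.restrictScalars k ⊓ degPart k n d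

/-- `Gr(r, R_d)`: the `r`-dimensional subspaces of `R_d`. -/
def grassR (n d r : ℕ) : Set (Submodule k (MvPolynomial (Fin n) k)) :=
  {V | V ≤ degPart k n d ∧ Module.finrank k V = r}

/-- The Reynolds operator `ρ(f) = (1 / n!) ∑ σ, σ · f`, where `σ · f = f(x_{σ(1)}, …, x_{σ(n)})`. -/
def reynolds (n : ℕ) : MvPolynomial (Fin n) k →ₗ[k] MvPolynomial (Fin n) k :=
  ((n.factorial : k)⁻¹) • ∑ σ : Equiv.Perm (Fin n), (rename (R := k) σ).toLinearMap

/-- `(F)_{𝔖_n}`: the ideal generated by all `σ · f` with `f ∈ F` and `σ ∈ 𝔖_n`. -/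
def symSpan {n : ℕ} (F : Set (MvPolynomial (Fin n) k)) : Ideal (MvPolynomial (Fin n) k) :=
  Ideal.span {g | ∃ σ : Equiv.Perm (Fin n), ∃ f ∈ F, g = rename σ f}

/-- An ideal is generated in degree `d` if it is generated by its elements that are homogeneous
of degree `d`. -/
def GeneratedInDegree {n : ℕ} (d : ℕ) (I : Ideal (MvPolynomial (Fin n) k)) : Prop :=
  I = Ideal.span (idealDegPart k I d : Set (MvPolynomial (Fin n) k))

/-! ### Partitions; the space `k^{P(d)}` and its identification with `R'_d` -/

/-- `P(d)`, the number of partitions of `d`. -/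
def numPart (d : ℕ) : ℕ := Fintype.card (Nat.Partition d)

/-- The monomial `x^λ = x_1^{λ_1} x_2^{λ_2} ⋯` with `λ_1 ≥ λ_2 ≥ ⋯` the parts of `λ`
(meaningful if `λ` has at most `n` parts, in particular if `n ≥ d`). -/
def partMonomial (n : ℕ) {d : ℕ} (l : Nat.Partition d) : MvPolynomial (Fin n) k :=
  ∏ i : Fin n, X i ^ (l.parts.sort (· ≥ ·)).getD i 0

/-- The symmetric polynomial `M_λ = ρ(x^λ)`. -/
def symM (n : ℕ) {d : ℕ} (l : Nat.Partition d) : MvPolynomial (Fin n) k :=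
  reynolds k n (partMonomial k n l)

/-- `k^{P(d)} → R'_d ⊆ R_d`, `(a_λ) ↦ ∑ a_λ M_λ`; for `n ≥ d` (and characteristic zero) this
identifies `k^{P(d)}` with the space `R'_d` of symmetric forms of degree `d`. -/
def toSym (n d : ℕ) : (Nat.Partition d → k) →ₗ[k] MvPolynomial (Fin n) k :=
  Fintype.linearCombination k (fun l : Nat.Partition d => symM k n l)

/-- `Gr(r, k^{P(d)})`. -/
def grassP (d r : ℕ) : Set (Submodule k (Nat.Partition d → k)) :=
  {U | Module.finrank k U = r}

/-- The Plücker coordinates of the subspace spanned by `v_1, …, v_r ∈ k^ι`: the `r × r` minors,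
indexed by all `r`-tuples of coordinates. -/
def plucker {ι : Type*} {r : ℕ} (v : Fin r → (ι → k)) (c : Fin r → ι) : k :=
  Matrix.det (Matrix.of fun i j : Fin r => v i (c j))

/-- Zariski open subsets of `Gr(r, k^ι)`: the sets of those `r`-dimensional subspaces at whose
Plücker coordinates some member of a given set of homogeneous polynomials does not vanish. -/
def IsZariskiOpen {ι : Type*} (r : ℕ) (G : Set (Submodule k (ι → k))) : Prop :=
  (∀ U ∈ G, Module.finrank k U = r) ∧
  ∃ T : Set (MvPolynomial (Fin r → ι) k),
    (∀ p ∈ T, ∃ e : ℕ, p.IsHomogeneous e) ∧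
    ∀ U : Submodule k (ι → k), ∀ b : Module.Basis (Fin r) k U,
      (U ∈ G ↔ ∃ p ∈ T, eval (plucker k fun i => (b i : ι → k)) p ≠ 0)

/-! ### The divided power module `S` with the contraction action, and inverse systems -/

/-- The underlying space of `S = k[y_1, …, y_n]_{DP}`: the vector space with basis the divided
power monomials `y^{(e)} = y_1^{(e_1)} ⋯ y_n^{(e_n)}`. -/
abbrev DPow (n : ℕ) : Type u := (Fin n →₀ ℕ) →₀ k

/-- Contraction on monomials: `x^a ∘ y^{(e)} = y^{(e - a)}` if `a ≤ e`, and `0` otherwise. -/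
def contractMon {n : ℕ} (a e : Fin n →₀ ℕ) : DPow k n :=
  open scoped Classical in if a ≤ e then Finsupp.single (e - a) 1 else 0

/-- The contraction `f ∘ g` of `g ∈ S` by `f ∈ R`: the bilinear extension of `contractMon`. -/
def contract {n : ℕ} (f : MvPolynomial (Fin n) k) (g : DPow k n) : DPow k n :=
  ∑ a ∈ f.support, ∑ e ∈ g.support, (coeff a f * g e) • contractMon k a e

theorem contract_apply {n : ℕ} (f : MvPolynomial (Fin n) k) (g : DPow k n) (b : Fin n →₀ ℕ) :
    contract k f g b = ∑ a ∈ f.support, coeff a f * g (a + b) := by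
  classical
  unfold contract
  rw [Finsupp.finsetSum_apply]
  refine Finset.sum_congr rfl fun a _ => ?_
  rw [Finsupp.finsetSum_apply]
  have h : ∀ e ∈ g.support, ((coeff a f * g e) • contractMon k a e) b
      = if e = a + b then coeff a f * g e else 0 := by
    intro e _
    unfold contractMon
    by_cases hae : a ≤ e
    · have : (e - a = b) ↔ (e = a + b) := by
        rw [tsub_eq_iff_eq_add_of_le hae, add_comm]
      rw [if_pos hae, Finsupp.smul_apply, Finsupp.single_apply, if_congr this rfl rfl, smul_eq_mul,
        mul_ite, mul_one, mul_zero]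
    · have : e ≠ a + b := fun h => hae (h ▸ le_self_add)
      simp [hae, this]
  rw [Finset.sum_congr rfl h, Finset.sum_ite_eq']
  by_cases hm : a + b ∈ g.support
  · simp [hm]
  · simp only [hm, if_false]
    rw [Finsupp.notMem_support_iff.mp hm, mul_zero]

theorem contract_apply_sum {n : ℕ} (f : MvPolynomial (Fin n) k) (g : DPow k n)
    (b : Fin n →₀ ℕ) (s : Finset (Fin n →₀ ℕ)) (hs : f.support ⊆ s) :
    contract k f g b = ∑ a ∈ s, coeff a f * g (a + b) := by
  rw [contract_apply]
  refine Finset.sum_subset hs fun a _ ha => ?_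
  rw [notMem_support_iff.mp ha, zero_mul]

theorem contract_zero_left {n : ℕ} (g : DPow k n) : contract k 0 g = 0 := by
  simp [contract]

theorem contract_zero_right {n : ℕ} (f : MvPolynomial (Fin n) k) :
    contract k f (0 : DPow k n) = 0 := by
  simp [contract]

theorem contract_add_left {n : ℕ} (f f' : MvPolynomial (Fin n) k) (g : DPow k n) :
    contract k (f + f') g = contract k f g + contract k f' g := by
  classical
  ext b
  rw [Finsupp.add_apply,
    contract_apply_sum k (f + f') g b (f.support ∪ f'.support) support_add,
    contract_apply_sum k f g b (f.support ∪ f'.support) Finset.subset_union_left,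
    contract_apply_sum k f' g b (f.support ∪ f'.support) Finset.subset_union_right,
    ← Finset.sum_add_distrib]
  refine Finset.sum_congr rfl fun a _ => ?_
  rw [coeff_add, add_mul]

theorem contract_monomial_mul {n : ℕ} (c : Fin n →₀ ℕ) (t : k) (f : MvPolynomial (Fin n) k)
    (g : DPow k n) :
    contract k (monomial c t * f) g = contract k (monomial c t) (contract k f g) := by
  classical
  ext b
  rw [contract_apply_sum k (monomial c t) _ b {c} support_monomial_subset,
    Finset.sum_singleton, contract_apply k f g,
    contract_apply_sum k (monomial c t * f) g b (f.support.map (addLeftEmbedding c)),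
    Finset.sum_map, Finset.mul_sum]
  · refine Finset.sum_congr rfl fun a _ => ?_
    rw [addLeftEmbedding_apply, coeff_monomial_mul, coeff_monomial, if_pos rfl, mul_assoc,
      show c + a + b = a + (c + b) by abel]
  · intro a ha
    have h := support_mul _ _ ha
    obtain ⟨x, hx, y, hy, rfl⟩ := Finset.mem_add.mp h
    have hxc := Finset.mem_singleton.mp (support_monomial_subset hx)
    subst hxc
    exact Finset.mem_map.mpr ⟨y, hy, rfl⟩

/-- Contraction makes `S` an `R`-module. -/
theorem contract_mul {n : ℕ} (p f : MvPolynomial (Fin n) k) (g : DPow k n) :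
    contract k (p * f) g = contract k p (contract k f g) := by
  induction p using MvPolynomial.induction_on' with
  | monomial c t => exact contract_monomial_mul k c t f g
  | add p q hp hq => rw [add_mul, contract_add_left, contract_add_left, hp, hq]

/-- `Ann_R(N)` for a subspace `N` of `S`. -/
def annR {n : ℕ} (N : Submodule k (DPow k n)) : Ideal (MvPolynomial (Fin n) k) where
  carrier := {f | ∀ g ∈ N, contract k f g = 0}
  zero_mem' := fun g _ => contract_zero_left k g
  add_mem' := fun {f f'} hf hf' g hg => by rw [contract_add_left, hf g hg, hf' g hg, add_zero]
  smul_mem' := fun p f hf g hg => by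
    rw [smul_eq_mul, contract_mul, hf g hg, contract_zero_right]

/-- `S'_{-d}`: the elements of `S` that are homogeneous of degree `-d` (every `y_i` has degree
`-1`) and invariant under all permutations of the variables. -/
def symDPow (n d : ℕ) : Submodule k (DPow k n) where
  carrier := {w | (∀ e, w e ≠ 0 → e.degree = d) ∧
    ∀ (σ : Equiv.Perm (Fin n)) (e : Fin n →₀ ℕ), w (e.mapDomain σ) = w e}
  zero_mem' := ⟨fun e h => absurd rfl h, fun _ _ => rfl⟩
  add_mem' := fun {v w} hv hw => by
    refine ⟨fun e h => ?_, fun σ e => ?_⟩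
    · by_cases h0 : v e = 0
      · exact hw.1 e fun h1 => h (by rw [Finsupp.add_apply, h0, h1, add_zero])
      · exact hv.1 e h0
    · rw [Finsupp.add_apply, Finsupp.add_apply, hv.2, hw.2]
  smul_mem' := fun c w hw => by
    refine ⟨fun e h => hw.1 e fun h0 => h (by rw [Finsupp.smul_apply, h0, smul_zero]),
      fun σ e => ?_⟩
    rw [Finsupp.smul_apply, Finsupp.smul_apply, hw.2]

/-- `S_{≥ -d+1}`: the span of the divided power monomials in less than `d` factors, that is, of
degree at least `-d + 1`. -/
def dpowLow (n d : ℕ) : Submodule k (DPow k n) :=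
  Finsupp.supported k k {e : Fin n →₀ ℕ | e.degree < d}

theorem contract_add_right {n : ℕ} (f : MvPolynomial (Fin n) k) (g g' : DPow k n) :
    contract k f (g + g') = contract k f g + contract k f g' := by
  ext b
  simp only [Finsupp.add_apply, contract_apply, mul_add, Finset.sum_add_distrib]

theorem contract_smul_right {n : ℕ} (f : MvPolynomial (Fin n) k) (c : k) (g : DPow k n) :
    contract k f (c • g) = c • contract k f g := by
  ext b
  simp only [Finsupp.smul_apply, contract_apply, smul_eq_mul, Finset.mul_sum]
  exact Finset.sum_congr rfl fun a _ => by ring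

/-- `U^⊥ = {w ∈ S'_{-d} : u ∘ w = 0 for all u ∈ U}`, for a subspace `U` of `R`. -/
def perp {n : ℕ} (d : ℕ) (U : Submodule k (MvPolynomial (Fin n) k)) :
    Submodule k (DPow k n) where
  carrier := {w | w ∈ symDPow k n d ∧ ∀ u ∈ U, contract k u w = 0}
  zero_mem' := ⟨Submodule.zero_mem _, fun u _ => contract_zero_right k u⟩
  add_mem' := fun {v w} hv hw => ⟨Submodule.add_mem _ hv.1 hw.1, fun u hu => by
    rw [contract_add_right, hv.2 u hu, hw.2 u hu, add_zero]⟩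
  smul_mem' := fun c w hw => ⟨Submodule.smul_mem _ c hw.1, fun u hu => by
    rw [contract_smul_right, hw.2 u hu, smul_zero]⟩

/-! ### The maps `Φ_n`, `Ψ_n`, `α_n`, `π_{m,n}`, `η_{m,n}` -/

/-- `Φ_n(V) = (V)_{𝔖_n}`. -/
def Phi (n : ℕ) (V : Submodule k (MvPolynomial (Fin n) k)) : Ideal (MvPolynomial (Fin n) k) :=
  symSpan k (V : Set (MvPolynomial (Fin n) k))

/-- `Ψ_n(U) = Ann_R(U^⊥ + S_{≥ -d+1})`, where `U ⊆ k^{P(d)}` is regarded as a subspace of `R'_d`. -/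
def Psi (n : ℕ) {d : ℕ} (U : Submodule k (Nat.Partition d → k)) :
    Ideal (MvPolynomial (Fin n) k) :=
  annR k (perp k d (U.map (toSym k n d)) ⊔ dpowLow k n d)

/-- `α_n(V) = {ρ(f) : f ∈ V}`, a subspace of `R'_d`, regarded as a subspace of `k^{P(d)}`. -/
def alpha (n d : ℕ) (V : Submodule k (MvPolynomial (Fin n) k)) :
    Submodule k (Nat.Partition d → k) :=
  (V.map (reynolds k n)).comap (toSym k n d)

/-- The inclusion `R_m ⊆ R_n` for `m ≤ n`. -/
def incl {m n : ℕ} (h : m ≤ n) : MvPolynomial (Fin m) k →ₐ[k] MvPolynomial (Fin n) k :=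
  rename (Fin.castLE h)

/-- `π_{m,n}(V) = V`, regarded as a subspace of `R_n`. -/
def piMap {m n : ℕ} (h : m ≤ n) (V : Submodule k (MvPolynomial (Fin m) k)) :
    Submodule k (MvPolynomial (Fin n) k) :=
  V.map (incl k h).toLinearMap

/-- `η_{m,n}(I) = I_{𝔖_n}`. -/
def eta {m n : ℕ} (h : m ≤ n) (I : Ideal (MvPolynomial (Fin m) k)) :
    Ideal (MvPolynomial (Fin n) k) :=
  symSpan k (incl k h '' (I : Set (MvPolynomial (Fin m) k)))

/-! ### General symmetric ideals -/

/-- `G` is an admissible parameter set, independent of the number of variables: a nonempty Zariski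
open subset of `Gr(r, k^{P(d)})` such that the ideals `Ψ_n(U)`, `U ∈ G`, are generated in
degree `d`, for all `n > d`. -/
structure IsParameterSet (d r : ℕ) (G : Set (Submodule k (Nat.Partition d → k))) : Prop where
  nonempty : G.Nonempty
  isOpen : IsZariskiOpen k r G
  generated : ∀ n : ℕ, d < n → ∀ U ∈ G, GeneratedInDegree k d (Psi k n U)

/-- The set `Õ_n` of all `V ∈ Gr(r, R_d)` with
`dim [(V)_{𝔖_n}]_d ≥ dim R_d - max (P(d) - r) 0` (natural subtraction is the maximum with `0`). -/
def setOTilde (n d r : ℕ) : Set (Submodule k (MvPolynomial (Fin n) k)) :=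
  {V | V ∈ grassR k n d r ∧
    Module.finrank k (degPart k n d) ≤
      Module.finrank k (idealDegPart k (Phi k n V) d) + (numPart d - r)}

/-- The set `O_n`: it is `Õ_n ∩ α_n⁻¹(G)` if `r < P(d)`, and `Õ_n` otherwise. -/
def setO (n d r : ℕ) (G : Set (Submodule k (Nat.Partition d → k))) :
    Set (Submodule k (MvPolynomial (Fin n) k)) :=
  {V | V ∈ setOTilde k n d r ∧ (r < numPart d → alpha k n d V ∈ G)}

/-- The set of general `(r,d)`-symmetric ideals of `R_n` (with respect to `G`): the ideals
`(V)_{𝔖_n}` with `V ∈ O_n`. -/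
def generalIdeals (n d r : ℕ) (G : Set (Submodule k (Nat.Partition d → k))) :
    Set (Ideal (MvPolynomial (Fin n) k)) :=
  Phi k n '' setO k n d r G

end SymIdeal

end

noncomputable section

namespace SymIdeal

universe u

variable {k : Type u} [Field k]

/-! ### The type of a monomial -/

/-! Everything is read through the type coordinates `typeCoeff`, which send a monomial of degree `d`
to the basis vector of its partition. They are unchanged by injective renaming of variables, hence
do not see the number of variables. On forms of degree `d` the Reynolds operator is `toSym` after
`typeCoeff`, so `alpha` is the image under `typeCoeff` (`alpha_eq_map`), and `Psi k n U` consists of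
the polynomials without terms below degree `d` whose type coordinates lie in `U` (`mem_Psi`).

The key fact is `IsPermStable.containsPermDiffs`: a permutation-stable subspace of codimension at
most `D` in degree `d` contains all differences of monomials of equal type as soon as `d + D < n`.
Thus for `V` in `setOTilde` the ideal `Phi k n V` contains the kernel of the Reynolds operator in
degree `d`, and the two ideals `Phi k n V` and `Psi k n (alpha k n d V)` agree there. Generation in
degree `d` turns this into equality (`Psi_alpha_eq_Phi`).

Conversely every `U` in `G` is some `alpha k n d V` (`exists_alpha_eq`): lift `U` along a section of
`typeCoeff` supported on monomials in disjoint variables. So `Psi` is a bijection from `G` to the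
general ideals for every large `n`. The containment of differences survives adding variables
(`ContainsPermDiffs.piMap`), so `eta` carries `Psi k m U` to `Psi k n U`, and its bijectivity
follows.

A parameter set is given by the subspaces not inside the hyperplane of coordinate sum zero: modulo
the differences all monomials of degree `d + 1` coincide, and one form with nonzero coefficient sum
then kills them all (`generatedInDegree_Psi`). -/

/-- The multiset of the nonzero exponents of the monomial with exponent vector `e`. -/
def expParts {n : ℕ} (e : Fin n →₀ ℕ) : Multiset ℕ :=
  e.support.val.map e

theorem sum_expParts {n : ℕ} (e : Fin n →₀ ℕ) : (expParts e).sum = e.degree := rfl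

theorem pos_of_mem_expParts {n : ℕ} {e : Fin n →₀ ℕ} {i : ℕ} (hi : i ∈ expParts e) : 0 < i := by
  obtain ⟨j, hj, rfl⟩ := Multiset.mem_map.mp hi
  exact Nat.pos_of_ne_zero (Finsupp.mem_support_iff.mp hj)

theorem card_expParts {n : ℕ} (e : Fin n →₀ ℕ) : (expParts e).card = e.support.card := by
  simp [expParts]

theorem card_support_le_degree {n : ℕ} (e : Fin n →₀ ℕ) : e.support.card ≤ e.degree := by
  rw [Finsupp.degree_apply, Finset.card_eq_sum_ones]
  exact Finset.sum_le_sum fun i hi => Nat.pos_of_ne_zero (Finsupp.mem_support_iff.mp hi)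

theorem expParts_mapDomain {m n : ℕ} {f : Fin m → Fin n} (hf : Function.Injective f)
    (e : Fin m →₀ ℕ) : expParts (e.mapDomain f) = expParts e := by
  classical
  unfold expParts
  rw [Finsupp.mapDomain_support_of_injective hf, Finset.image_val_of_injOn hf.injOn,
    Multiset.map_map]
  exact Multiset.map_congr rfl fun i _ => Finsupp.mapDomain_apply hf e i

theorem map_univ_eq_expParts_add {n : ℕ} (e : Fin n →₀ ℕ) :
    Finset.univ.val.map e = expParts e + Multiset.replicate (n - e.support.card) 0 := by
  classical
  have h : (Finset.univ : Finset (Fin n)).val = e.support.val + (e.supportᶜ).val := by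
    rw [← Finset.disjUnion_val _ _ disjoint_compl_right, Finset.disjUnion_eq_union,
      Finset.union_compl]
  rw [h, Multiset.map_add, expParts]
  congr 1
  rw [Multiset.eq_replicate]
  refine ⟨by simp [Finset.card_compl], fun b hb => ?_⟩
  obtain ⟨j, hj, rfl⟩ := Multiset.mem_map.mp hb
  simpa using hj

/-- Exponent vectors of the same type differ by a permutation of the variables. -/
theorem exists_perm_of_expParts_eq {n : ℕ} {e e' : Fin n →₀ ℕ} (h : expParts e = expParts e') :
    ∃ σ : Equiv.Perm (Fin n), e' = e.mapDomain σ := by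
  have hm : Finset.univ.val.map e = Finset.univ.val.map e' := by
    rw [map_univ_eq_expParts_add, map_univ_eq_expParts_add, ← card_expParts, ← card_expParts, h]
  rw [Fin.univ_val_map, Fin.univ_val_map, Multiset.coe_eq_coe] at hm
  -- Both exponent tuples are sorted. Sorted lists that are permutations of each other are equal, so
  -- one sorting permutation followed by the inverse of the other does the job.
  have hp : (List.ofFn (e ∘ Tuple.sort e)).Perm (List.ofFn (e' ∘ Tuple.sort e')) :=
    ((Equiv.Perm.ofFn_comp_perm _ _).trans hm).trans (Equiv.Perm.ofFn_comp_perm _ _).symm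
  have hs := hp.eq_of_pairwise' (Tuple.monotone_sort e).sortedLE_ofFn.pairwise
    (Tuple.monotone_sort e').sortedLE_ofFn.pairwise
  have hc := List.ofFn_injective hs
  refine ⟨(Tuple.sort e).symm.trans (Tuple.sort e'), ?_⟩
  ext i
  rw [Finsupp.mapDomain_equiv_apply]
  have := congrFun hc ((Tuple.sort e').symm i)
  simpa using this.symm

/-- The exponent vector of `x^λ`. -/
def partExp (n : ℕ) {d : ℕ} (l : Nat.Partition d) : Fin n →₀ ℕ :=
  Finsupp.equivFunOnFinite.symm fun i => (l.parts.sort (· ≥ ·)).getD i 0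

theorem partMonomial_eq (n : ℕ) {d : ℕ} (l : Nat.Partition d) :
    partMonomial k n l = monomial (partExp n l) 1 := by
  rw [monomial_eq, C_1, one_mul, Finsupp.prod_fintype _ _ (by simp)]
  rfl

theorem card_parts_le {d : ℕ} (l : Nat.Partition d) : l.parts.card ≤ d := by
  calc l.parts.card = (l.parts.map fun _ => 1).sum := by simp
    _ ≤ (l.parts.map id).sum := Multiset.sum_map_le_sum_map _ _ fun i hi => l.parts_pos hi
    _ = d := by rw [Multiset.map_id, l.parts_sum]

theorem expParts_partExp {n d : ℕ} (h : d ≤ n) (l : Nat.Partition d) :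
    expParts (partExp n l) = l.parts := by
  set L := l.parts.sort (· ≥ ·) with hL
  have hlen : L.length ≤ n := by
    rw [hL, Multiset.length_sort]; exact (card_parts_le l).trans h
  have hLp : (L : Multiset ℕ) = l.parts := Multiset.sort_eq _ _
  have h1 : Finset.univ.val.map (partExp n l) =
      l.parts + Multiset.replicate (n - L.length) 0 := by
    rw [Fin.univ_val_map, ← hLp, ← Multiset.coe_replicate, Multiset.coe_add]
    congr 1
    refine List.ext_getElem (by simp; omega) fun i h1 h2 => ?_
    simp only [List.getElem_ofFn, partExp, Finsupp.equivFunOnFinite_symm_apply_apply, ← hL]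
    by_cases hi : i < L.length
    · simp [hi]
    · simp [hi, List.getElem_append]
  rw [map_univ_eq_expParts_add] at h1
  have h2 := congrArg (Multiset.filter (· ≠ 0)) h1
  have hrep : ∀ a, Multiset.filter (· ≠ 0) (Multiset.replicate a 0) = 0 := fun a =>
    Multiset.filter_eq_nil.mpr fun b hb => by simp [Multiset.eq_of_mem_replicate hb]
  rw [Multiset.filter_add, Multiset.filter_add, hrep, hrep, add_zero, add_zero,
    Multiset.filter_eq_self.mpr fun b hb => (pos_of_mem_expParts hb).ne',
    Multiset.filter_eq_self.mpr fun b hb => (l.parts_pos hb).ne'] at h2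
  exact h2

theorem degree_partExp {n d : ℕ} (h : d ≤ n) (l : Nat.Partition d) :
    (partExp n l).degree = d := by
  rw [← sum_expParts, expParts_partExp h, l.parts_sum]

/-- The partition formed by the nonzero exponents of a monomial of degree `d`. -/
def expPartition {n d : ℕ} (e : Fin n →₀ ℕ) (he : e.degree = d) : Nat.Partition d where
  parts := expParts e
  parts_pos := pos_of_mem_expParts
  parts_sum := he

/-! ### Coordinates of the Reynolds operator -/

variable (k) in
/-- The linear map `R_n → k^{P(d)}` sending a monomial of degree `d` to the basis vector of its
type, and the monomials of other degrees to zero. -/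
def typeCoeff (n d : ℕ) : MvPolynomial (Fin n) k →ₗ[k] (Nat.Partition d → k) :=
  (basisMonomials (Fin n) k).constr k fun e l =>
    open scoped Classical in if expParts e = l.parts then 1 else 0

open scoped Classical in
theorem typeCoeff_monomial {n d : ℕ} (e : Fin n →₀ ℕ) (c : k) (l : Nat.Partition d) :
    typeCoeff k n d (monomial e c) l = if expParts e = l.parts then c else 0 := by
  have h := (basisMonomials (Fin n) k).constr_basis k (fun (e : Fin n →₀ ℕ)
    (l : Nat.Partition d) => if expParts e = l.parts then (1 : k) else 0) e
  rw [coe_basisMonomials] at h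
  have h2 : monomial e c = c • monomial e (1 : k) := by rw [smul_monomial, smul_eq_mul, mul_one]
  rw [h2, map_smul, typeCoeff]
  erw [h]
  simp

theorem typeCoeff_monomial_of_degree_ne {n d : ℕ} {e : Fin n →₀ ℕ} (he : e.degree ≠ d) (c : k) :
    typeCoeff k n d (monomial e c) = 0 := by
  classical
  ext l
  rw [typeCoeff_monomial, if_neg, Pi.zero_apply]
  intro h
  exact he (by rw [← sum_expParts, h, l.parts_sum])

open scoped Classical in
theorem typeCoeff_monomial_of_expParts {n d : ℕ} {e : Fin n →₀ ℕ} {l : Nat.Partition d}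
    (h : expParts e = l.parts) (c : k) :
    typeCoeff k n d (monomial e c) = Pi.single l c := by
  ext l'
  rw [typeCoeff_monomial, Pi.single_apply, h]
  congr 1
  rw [← Nat.Partition.ext_iff]
  exact propext eq_comm

/-- Injective renaming preserves types. This serves twice: for permutations of the variables, and
for the inclusion of `m` variables into `n`. -/
theorem typeCoeff_rename {m n d : ℕ} {f : Fin m → Fin n} (hf : Function.Injective f)
    (p : MvPolynomial (Fin m) k) : typeCoeff k n d (rename f p) = typeCoeff k m d p := by
  induction p using MvPolynomial.induction_on' with
  | monomial e c =>
    ext l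
    rw [rename_monomial, typeCoeff_monomial, typeCoeff_monomial, expParts_mapDomain hf]
  | add p q hp hq => rw [map_add, map_add, map_add, hp, hq]

theorem reynolds_apply {n : ℕ} (f : MvPolynomial (Fin n) k) :
    reynolds k n f = (n.factorial : k)⁻¹ • ∑ σ : Equiv.Perm (Fin n), rename σ f := by
  simp [reynolds]

theorem reynolds_rename {n : ℕ} (σ : Equiv.Perm (Fin n)) (f : MvPolynomial (Fin n) k) :
    reynolds k n (rename σ f) = reynolds k n f := by
  rw [reynolds_apply, reynolds_apply]
  congr 1
  refine Fintype.sum_equiv (Equiv.mulRight σ) _ _ fun τ => ?_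
  rw [rename_rename]
  rfl

/-- The difference `f - ρ(f)` is the average of the differences `f - σ · f`. -/
theorem reynolds_mem_of_rename_sub [CharZero k] {n : ℕ} {f : MvPolynomial (Fin n) k}
    {I : Submodule k (MvPolynomial (Fin n) k)}
    (h : ∀ σ : Equiv.Perm (Fin n), f - rename σ f ∈ I) : f - reynolds k n f ∈ I := by
  have hn : (n.factorial : k) ≠ 0 := Nat.cast_ne_zero.mpr n.factorial_ne_zero
  have : f - reynolds k n f =
      (n.factorial : k)⁻¹ • ∑ σ : Equiv.Perm (Fin n), (f - rename σ f) := by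
    rw [Finset.sum_sub_distrib, smul_sub, ← reynolds_apply, Finset.sum_const, Finset.card_univ,
      Fintype.card_perm, Fintype.card_fin, ← Nat.cast_smul_eq_nsmul k, smul_smul,
      inv_mul_cancel₀ hn, one_smul]
  rw [this]
  exact I.smul_mem _ (I.sum_mem fun σ _ => h σ)

theorem typeCoeff_reynolds [CharZero k] {n d : ℕ} (f : MvPolynomial (Fin n) k) :
    typeCoeff k n d (reynolds k n f) = typeCoeff k n d f := by
  have h := reynolds_mem_of_rename_sub (f := f) (I := LinearMap.ker (typeCoeff k n d))
    fun σ => by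
      rw [LinearMap.mem_ker, map_sub, typeCoeff_rename σ.injective, sub_self]
  rw [LinearMap.mem_ker, map_sub, sub_eq_zero] at h
  exact h.symm

theorem toSym_apply {n d : ℕ} (c : Nat.Partition d → k) :
    toSym k n d c = ∑ l, c l • symM k n l := by
  rw [toSym, Fintype.linearCombination_apply]

theorem isHomogeneous_reynolds {n d : ℕ} {f : MvPolynomial (Fin n) k} (hf : f.IsHomogeneous d) :
    (reynolds k n f).IsHomogeneous d := by
  rw [reynolds_apply]
  exact (degPart k n d).smul_mem _
    ((degPart k n d).sum_mem fun σ _ => hf.rename_isHomogeneous)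

theorem isHomogeneous_partMonomial {n d : ℕ} (h : d ≤ n) (l : Nat.Partition d) :
    (partMonomial k n l).IsHomogeneous d := by
  rw [partMonomial_eq]
  exact isHomogeneous_monomial _ (degree_partExp h l)

theorem isHomogeneous_toSym {n d : ℕ} (h : d ≤ n) (c : Nat.Partition d → k) :
    (toSym k n d c).IsHomogeneous d := by
  rw [toSym_apply]
  exact (degPart k n d).sum_mem fun l _ => (degPart k n d).smul_mem _
    (isHomogeneous_reynolds (isHomogeneous_partMonomial h l))

theorem typeCoeff_toSym [CharZero k] {n d : ℕ} (h : d ≤ n) (c : Nat.Partition d → k) :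
    typeCoeff k n d (toSym k n d c) = c := by
  classical
  rw [toSym_apply, map_sum]
  have : ∀ l, typeCoeff k n d (c l • symM k n l) = Pi.single l (c l) := fun l => by
    rw [map_smul, symM, typeCoeff_reynolds, partMonomial_eq,
      typeCoeff_monomial_of_expParts (expParts_partExp h l), ← Pi.single_smul, smul_eq_mul, mul_one]
  simp_rw [this]
  exact Finset.univ_sum_single c

/-- Two linear maps on `R_n` which agree on the monomials of degree `d` agree on `R_d`. -/
theorem IsHomogeneous.linearMap_ext {n d : ℕ} {M : Type*} [AddCommGroup M] [Module k M]
    {A B : MvPolynomial (Fin n) k →ₗ[k] M}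
    (h : ∀ e : Fin n →₀ ℕ, e.degree = d → A (monomial e 1) = B (monomial e 1))
    {f : MvPolynomial (Fin n) k} (hf : f.IsHomogeneous d) : A f = B f := by
  rw [← support_sum_monomial_coeff f, map_sum, map_sum]
  refine Finset.sum_congr rfl fun e he => ?_
  have h2 : monomial e (coeff e f) = coeff e f • monomial e (1 : k) := by
    rw [smul_monomial, smul_eq_mul, mul_one]
  have hd : e.degree = d := by
    by_contra hne
    exact mem_support_iff.mp he (hf.coeff_eq_zero hne)
  rw [h2, map_smul, map_smul, h e hd]

/-- By linearity this is a statement about one monomial of degree `d`. It is a permutation of the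
monomial `x^λ` of its type, and the Reynolds operator does not distinguish the two. -/
theorem reynolds_eq_toSym [CharZero k] {n d : ℕ} (h : d ≤ n) {f : MvPolynomial (Fin n) k}
    (hf : f.IsHomogeneous d) : reynolds k n f = toSym k n d (typeCoeff k n d f) := by
  classical
  refine IsHomogeneous.linearMap_ext (A := reynolds k n)
    (B := (toSym k n d).comp (typeCoeff k n d)) (fun e he => ?_) hf
  obtain ⟨σ, hσ⟩ := exists_perm_of_expParts_eq (e := partExp n (expPartition e he)) (e' := e)
    (expParts_partExp h _)
  rw [LinearMap.comp_apply, typeCoeff_monomial_of_expParts (l := expPartition e he) rfl,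
    toSym_apply, Finset.sum_eq_single (expPartition e he)
      (fun l _ hl => by rw [Pi.single_eq_of_ne hl, zero_smul]) (by simp),
    Pi.single_eq_same, one_smul, symM, partMonomial_eq, ← reynolds_rename σ (monomial (partExp n _) 1),
    rename_monomial, ← hσ]

theorem alpha_eq_map [CharZero k] {n d : ℕ} (h : d ≤ n)
    {V : Submodule k (MvPolynomial (Fin n) k)} (hV : V ≤ degPart k n d) :
    alpha k n d V = V.map (typeCoeff k n d) := by
  ext c
  simp only [alpha, Submodule.mem_comap, Submodule.mem_map]
  refine exists_congr fun f => and_congr_right fun hf => ?_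
  rw [reynolds_eq_toSym h (hV hf)]
  refine ⟨fun hc => ?_, fun hc => by rw [hc]⟩
  rw [← typeCoeff_toSym h c, ← hc, typeCoeff_toSym h]

theorem typeCoeff_homogeneousComponent {n d : ℕ} (f : MvPolynomial (Fin n) k) :
    typeCoeff k n d (homogeneousComponent d f) = typeCoeff k n d f := by
  classical
  induction f using MvPolynomial.induction_on' with
  | monomial e c =>
    by_cases he : e.degree = d
    · rw [homogeneousComponent_of_mem (isHomogeneous_monomial c he), if_pos rfl]
    · rw [homogeneousComponent_of_mem (isHomogeneous_monomial c rfl), if_neg (Ne.symm he),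
        map_zero, typeCoeff_monomial_of_degree_ne he]
  | add p q hp hq => rw [map_add, map_add, map_add, hp, hq]

/-! ### The ideals `Ψ_n(U)` -/

theorem contract_single {n : ℕ} (f : MvPolynomial (Fin n) k) (e : Fin n →₀ ℕ) :
    contract k f (Finsupp.single e 1) 0 = coeff e f := by
  classical
  rw [contract_apply]
  by_cases he : e ∈ f.support
  · rw [Finset.sum_eq_single e (fun b _ hb => by simp [hb.symm])
      (fun h => absurd he h)]
    simp
  · rw [notMem_support_iff.mp he]
    refine Finset.sum_eq_zero fun a ha => ?_
    have : e ≠ a := fun h => he (h ▸ ha)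
    simp [this]

theorem contract_monomial_apply_zero {n : ℕ} (e : Fin n →₀ ℕ) (c : k) (w : DPow k n) :
    contract k (monomial e c) w 0 = c * w e := by
  classical
  rw [contract_apply_sum k _ w 0 {e} support_monomial_subset]
  simp

/-- The pairing of a polynomial with an invariant element of degree `-d` of the divided power
algebra only depends on the type coordinates of the polynomial. -/
theorem contract_apply_zero_of_mem_symDPow {n d : ℕ} (h : d ≤ n) {w : DPow k n}
    (hw : w ∈ symDPow k n d) (f : MvPolynomial (Fin n) k) :
    contract k f w 0 = ∑ l, typeCoeff k n d f l * w (partExp n l) := by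
  classical
  induction f using MvPolynomial.induction_on' with
  | monomial e c =>
    rw [contract_monomial_apply_zero]
    by_cases he : e.degree = d
    · obtain ⟨σ, hσ⟩ := exists_perm_of_expParts_eq (e := partExp n (expPartition e he)) (e' := e)
        (expParts_partExp h _)
      rw [typeCoeff_monomial_of_expParts (l := expPartition e he) rfl,
        Finset.sum_eq_single (expPartition e he)
          (fun l _ hl => by rw [Pi.single_eq_of_ne hl, zero_mul]) (by simp),
        Pi.single_eq_same, ← hw.2 σ (partExp n _), ← hσ]
    · have h0 : w e = 0 := by
        by_contra hne
        exact he (hw.1 e hne)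
      rw [typeCoeff_monomial_of_degree_ne he, h0]
      simp
  | add p q hp hq =>
    rw [contract_add_left, Finsupp.add_apply, hp, hq, map_add, ← Finset.sum_add_distrib]
    exact Finset.sum_congr rfl fun l _ => by rw [Pi.add_apply, add_mul]

/-- Degree reasons: a nonzero value of `w` at `a + b` forces `a` to have degree less than `d`. -/
theorem contract_apply_eq_zero_of_mem_symDPow {n d : ℕ} {w : DPow k n}
    (hw : w ∈ symDPow k n d) {f : MvPolynomial (Fin n) k}
    (hf : ∀ e : Fin n →₀ ℕ, e.degree < d → coeff e f = 0) {b : Fin n →₀ ℕ} (hb : b ≠ 0) :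
    contract k f w b = 0 := by
  rw [contract_apply]
  refine Finset.sum_eq_zero fun a ha => ?_
  by_cases h0 : w (a + b) = 0
  · rw [h0, mul_zero]
  · have h1 := hw.1 _ h0
    have h2 : b.degree ≠ 0 := fun h => hb ((Finsupp.degree_eq_zero_iff b).mp h)
    rw [map_add] at h1
    rw [hf a (by omega), zero_mul]

theorem contract_eq_zero_of_mem_dpowLow {n d : ℕ} {w : DPow k n} (hw : w ∈ dpowLow k n d)
    {f : MvPolynomial (Fin n) k} (hf : ∀ e : Fin n →₀ ℕ, e.degree < d → coeff e f = 0) :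
    contract k f w = 0 := by
  ext b
  rw [contract_apply, Finsupp.zero_apply]
  refine Finset.sum_eq_zero fun a ha => ?_
  by_cases h0 : w (a + b) = 0
  · rw [h0, mul_zero]
  · have h1 : (a + b).degree < d :=
      (Finsupp.mem_supported k w).mp hw (Finsupp.mem_support_iff.mpr h0)
    rw [map_add] at h1
    rw [hf a (by omega), zero_mul]

/-- The invariant element of the divided power algebra which represents a linear form on
`k^{P(d)}`. -/
def dualDPow {d : ℕ} (n : ℕ) (φ : (Nat.Partition d → k) →ₗ[k] k) : DPow k n :=
  open scoped Classical in
  Finsupp.onFinset (Finsupp.finite_of_degree_eq (σ := Fin n) d).toFinset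
    (fun e => if e.degree = d then φ (typeCoeff k n d (monomial e 1)) else 0)
    (fun e he => by
      rw [Set.Finite.mem_toFinset]
      by_contra hne
      exact he (if_neg hne))

theorem dualDPow_apply {n d : ℕ} (φ : (Nat.Partition d → k) →ₗ[k] k) (e : Fin n →₀ ℕ) :
    dualDPow n φ e = φ (typeCoeff k n d (monomial e 1)) := by
  classical
  rw [dualDPow, Finsupp.onFinset_apply]
  split_ifs with h
  · rfl
  · rw [typeCoeff_monomial_of_degree_ne h, map_zero]

theorem dualDPow_mem {n d : ℕ} (φ : (Nat.Partition d → k) →ₗ[k] k) :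
    dualDPow n φ ∈ symDPow k n d := by
  refine ⟨fun e he => ?_, fun σ e => ?_⟩
  · by_contra h
    rw [dualDPow_apply, typeCoeff_monomial_of_degree_ne h, map_zero] at he
    exact he rfl
  · rw [dualDPow_apply, dualDPow_apply, ← rename_monomial, typeCoeff_rename σ.injective]

theorem contract_dualDPow_apply_zero {n d : ℕ} (φ : (Nat.Partition d → k) →ₗ[k] k)
    (f : MvPolynomial (Fin n) k) :
    contract k f (dualDPow n φ) 0 = φ (typeCoeff k n d f) := by
  induction f using MvPolynomial.induction_on' with
  | monomial e c =>
    have h2 : monomial e c = c • monomial e (1 : k) := by rw [smul_monomial, smul_eq_mul, mul_one]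
    rw [contract_monomial_apply_zero, dualDPow_apply, h2, map_smul, map_smul, smul_eq_mul]
  | add p q hp hq => rw [contract_add_left, Finsupp.add_apply, hp, hq, map_add, map_add]

theorem IsHomogeneous.coeff_eq_zero_of_degree_lt {n d : ℕ} {f : MvPolynomial (Fin n) k}
    (hf : f.IsHomogeneous d) (e : Fin n →₀ ℕ) (he : e.degree < d) : coeff e f = 0 :=
  hf.coeff_eq_zero he.ne

/-- Annihilating the divided powers of low degree means having no terms below degree `d`. The rest
is biduality: invariant elements of degree `-d` are the linear forms on the type coordinates, and
`perp` picks those vanishing on `U`. -/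
theorem mem_Psi [CharZero k] {n d : ℕ} (h : d ≤ n) {U : Submodule k (Nat.Partition d → k)}
    {f : MvPolynomial (Fin n) k} :
    f ∈ Psi k n U ↔
      (∀ e : Fin n →₀ ℕ, e.degree < d → coeff e f = 0) ∧ typeCoeff k n d f ∈ U := by
  constructor
  · intro hf
    have hlow : ∀ e : Fin n →₀ ℕ, e.degree < d → coeff e f = 0 := fun e he => by
      rw [← contract_single, hf _ (Submodule.mem_sup_right (Finsupp.single_mem_supported k 1 he)),
        Finsupp.zero_apply]
    refine ⟨hlow, ?_⟩
    by_contra hne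
    obtain ⟨φ, hφ, hU⟩ := Submodule.exists_le_ker_of_notMem hne
    refine hφ ?_
    rw [← contract_dualDPow_apply_zero, hf, Finsupp.zero_apply]
    refine Submodule.mem_sup_left ⟨dualDPow_mem φ, ?_⟩
    rintro _ ⟨c, hc, rfl⟩
    ext b
    rw [Finsupp.zero_apply]
    by_cases hb : b = 0
    · rw [hb, contract_dualDPow_apply_zero, typeCoeff_toSym h]
      exact hU hc
    · exact contract_apply_eq_zero_of_mem_symDPow (dualDPow_mem φ)
        (IsHomogeneous.coeff_eq_zero_of_degree_lt (isHomogeneous_toSym h c)) hb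
  · rintro ⟨hlow, hU⟩ g hg
    obtain ⟨w, hw, v, hv, rfl⟩ := Submodule.mem_sup.mp hg
    rw [contract_add_right, contract_eq_zero_of_mem_dpowLow hv hlow, add_zero]
    ext b
    rw [Finsupp.zero_apply]
    by_cases hb : b = 0
    -- The pairing with an invariant element sees only type coordinates, so `f` may be replaced by
    -- the symmetric form with the same coordinates, which `w` kills.
    · have h1 := hw.2 _ (Submodule.mem_map_of_mem hU)
      rw [hb, contract_apply_zero_of_mem_symDPow h hw.1, ← typeCoeff_toSym h (typeCoeff k n d f),
        ← contract_apply_zero_of_mem_symDPow h hw.1, h1, Finsupp.zero_apply]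
    · exact contract_apply_eq_zero_of_mem_symDPow hw.1 hlow hb

variable (k) in
/-- The forms of degree `d` whose symmetrization lies in `U`. -/
def symPreimage (n : ℕ) {d : ℕ} (U : Submodule k (Nat.Partition d → k)) :
    Submodule k (MvPolynomial (Fin n) k) :=
  U.comap (typeCoeff k n d) ⊓ degPart k n d

theorem idealDegPart_Psi [CharZero k] {n d : ℕ} (h : d ≤ n)
    (U : Submodule k (Nat.Partition d → k)) :
    idealDegPart k (Psi k n U) d = symPreimage k n U := by
  ext f
  simp only [idealDegPart, symPreimage, Submodule.mem_inf, Submodule.restrictScalars_mem,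
    mem_Psi h, Submodule.mem_comap]
  exact ⟨fun hf => ⟨hf.1.2, hf.2⟩,
    fun hf => ⟨⟨IsHomogeneous.coeff_eq_zero_of_degree_lt hf.2, hf.1⟩, hf.2⟩⟩

theorem map_symPreimage [CharZero k] {n d : ℕ} (h : d ≤ n)
    (U : Submodule k (Nat.Partition d → k)) :
    (symPreimage k n U).map (typeCoeff k n d) = U := by
  refine le_antisymm (Submodule.map_le_iff_le_comap.mpr inf_le_left) fun c hc => ?_
  exact ⟨toSym k n d c, ⟨by rwa [SetLike.mem_coe, Submodule.mem_comap, typeCoeff_toSym h],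
    isHomogeneous_toSym h c⟩, typeCoeff_toSym h c⟩

theorem Psi_injective [CharZero k] {n d : ℕ} (h : d ≤ n) :
    Function.Injective (Psi k n (d := d)) := fun U U' hU => by
  rw [← map_symPreimage h U, ← map_symPreimage h U', ← idealDegPart_Psi h, ← idealDegPart_Psi h,
    hU]

instance finite_degPart (n d : ℕ) : Module.Finite k (degPart k n d) :=
  Module.Finite.iff_fg.mpr (homogeneousSubmodule_fg (Fin n) k d)

theorem finite_of_le_degPart {n d : ℕ} {V : Submodule k (MvPolynomial (Fin n) k)}
    (hV : V ≤ degPart k n d) : Module.Finite k V :=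
  Submodule.finiteDimensional_of_le hV

theorem finrank_map_add_finrank_inf_ker {E F : Type*} [AddCommGroup E] [Module k E]
    [AddCommGroup F] [Module k F] (A : E →ₗ[k] F) (W : Submodule k E) [Module.Finite k W] :
    Module.finrank k (W.map A) + Module.finrank k (W ⊓ LinearMap.ker A : Submodule k E) =
      Module.finrank k W := by
  rw [← LinearMap.finrank_range_add_finrank_ker (A.domRestrict W), LinearMap.range_domRestrict,
    LinearMap.ker_domRestrict, ← Submodule.map_comap_subtype,
    Submodule.finrank_map_subtype_eq]

/-- Rank-nullity for `typeCoeff` on the preimage and on all of degree `d`: the kernels coincide, and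
the images are `U` and the whole space. -/
theorem finrank_symPreimage [CharZero k] {n d : ℕ} (h : d ≤ n)
    (U : Submodule k (Nat.Partition d → k)) :
    Module.finrank k (symPreimage k n U) + numPart d =
      Module.finrank k (degPart k n d) + Module.finrank k U := by
  have : Module.Finite k (symPreimage k n U) := finite_of_le_degPart inf_le_right
  have h1 := finrank_map_add_finrank_inf_ker (typeCoeff k n d) (symPreimage k n U)
  have h2 := finrank_map_add_finrank_inf_ker (typeCoeff k n d) (degPart k n d)
  have h3 : (degPart k n d).map (typeCoeff k n d) = ⊤ := by
    have := map_symPreimage (k := k) h ⊤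
    rwa [symPreimage, Submodule.comap_top, top_inf_eq] at this
  have h4 : symPreimage k n U ⊓ LinearMap.ker (typeCoeff k n d) =
      degPart k n d ⊓ LinearMap.ker (typeCoeff k n d) := by
    refine le_antisymm (inf_le_inf_right _ inf_le_right) fun f hf => ⟨⟨?_, hf.1⟩, hf.2⟩
    have : typeCoeff k n d f = 0 := hf.2
    rw [SetLike.mem_coe, Submodule.mem_comap, this]
    exact U.zero_mem
  rw [map_symPreimage h] at h1
  rw [h3, finrank_top, Module.finrank_fintype_fun_eq_card] at h2
  rw [h4] at h1
  unfold numPart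
  omega

/-! ### Stable ideals of small codimension contain the kernel of the Reynolds operator -/

/-- A subspace contains the differences of monomials of degree `d` which differ by a permutation of
the variables. -/
def ContainsPermDiffs {n : ℕ} (d : ℕ) (I : Submodule k (MvPolynomial (Fin n) k)) : Prop :=
  ∀ e : Fin n →₀ ℕ, e.degree = d → ∀ σ : Equiv.Perm (Fin n),
    monomial e 1 - monomial (e.mapDomain σ) 1 ∈ I

/-- Modulo `I` every form of degree `d` equals its symmetrization, which is determined by its type
coordinates. -/
theorem ContainsPermDiffs.mem [CharZero k] {n d : ℕ} (h : d ≤ n)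
    {I : Submodule k (MvPolynomial (Fin n) k)} (hI : ContainsPermDiffs d I)
    {f : MvPolynomial (Fin n) k} (hf : f.IsHomogeneous d) (h0 : typeCoeff k n d f = 0) :
    f ∈ I := by
  have h1 : I.mkQ f = (I.mkQ.comp (reynolds k n)) f := by
    refine IsHomogeneous.linearMap_ext (fun e he => ?_) hf
    rw [LinearMap.comp_apply, ← sub_eq_zero, ← map_sub, Submodule.mkQ_apply,
      Submodule.Quotient.mk_eq_zero]
    exact reynolds_mem_of_rename_sub fun σ => by rw [rename_monomial]; exact hI e he σ
  rw [LinearMap.comp_apply, reynolds_eq_toSym h hf, h0, map_zero, map_zero] at h1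
  rwa [Submodule.mkQ_apply, Submodule.Quotient.mk_eq_zero] at h1

theorem mapDomain_swap_apply {n : ℕ} (e : Fin n →₀ ℕ) (i j l : Fin n) :
    e.mapDomain (Equiv.swap i j) l = e (Equiv.swap i j l) := by
  rw [Finsupp.mapDomain_equiv_apply, Equiv.symm_swap]

theorem mapDomain_swap_eq_self {n : ℕ} {e : Fin n →₀ ℕ} {i j : Fin n} (h : e i = e j) :
    e.mapDomain (Equiv.swap i j) = e := by
  ext l
  rw [mapDomain_swap_apply]
  rcases eq_or_ne l i with rfl | hi
  · rw [Equiv.swap_apply_left, h]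
  rcases eq_or_ne l j with rfl | hj
  · rw [Equiv.swap_apply_right, h]
  rw [Equiv.swap_apply_of_ne_of_ne hi hj]

/-- It is enough to consider transpositions which move a variable to one that does not occur. -/
theorem containsPermDiffs_of_swap {n d : ℕ} (h : d < n)
    {I : Submodule k (MvPolynomial (Fin n) k)}
    (hI : ∀ (e : Fin n →₀ ℕ) (i j : Fin n), e.degree = d → e i ≠ 0 → e j = 0 →
      monomial e 1 - monomial (e.mapDomain (Equiv.swap i j)) 1 ∈ I) :
    ContainsPermDiffs d I := by
  have hdeg : ∀ (e : Fin n →₀ ℕ) (σ : Equiv.Perm (Fin n)), e.degree = d →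
      (e.mapDomain σ).degree = d := fun e σ he => by rw [Finsupp.degree_mapDomain, he]
  have h1 : ∀ (e : Fin n →₀ ℕ) (i j : Fin n), e.degree = d → e j = 0 →
      monomial e 1 - monomial (e.mapDomain (Equiv.swap i j)) 1 ∈ I := by
    intro e i j he hj
    by_cases hi : e i = 0
    · rw [mapDomain_swap_eq_self (hi.trans hj.symm), sub_self]
      exact I.zero_mem
    · exact hI e i j he hi hj
  have h2 : ∀ (e : Fin n →₀ ℕ) (i j : Fin n), i ≠ j → e.degree = d →
      monomial e 1 - monomial (e.mapDomain (Equiv.swap i j)) 1 ∈ I := by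
    intro e i j hij he
    by_cases hj : e j = 0
    · exact h1 e i j he hj
    by_cases hi : e i = 0
    · rw [Equiv.swap_comm]
      exact h1 e j i he hi
    obtain ⟨p, hp⟩ : ∃ p, e p = 0 := by
      by_contra hne
      push Not at hne
      have : e.support = Finset.univ :=
        Finset.eq_univ_of_forall fun p => Finsupp.mem_support_iff.mpr (hne p)
      have h3 := card_support_le_degree e
      rw [this, Finset.card_univ, Fintype.card_fin] at h3
      omega
    have hpi : p ≠ i := fun h => hi (h ▸ hp)
    have hpj : p ≠ j := fun h => hj (h ▸ hp)
    -- With `p` as a free slot, the exchange of `i` and `j` is done in three moves, each onto a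
    -- variable that is absent at that moment.
    set e₁ := e.mapDomain (Equiv.swap i p) with he₁
    set e₂ := e₁.mapDomain (Equiv.swap j i) with he₂
    have a1 := h1 e i p he hp
    have a2 := h1 e₁ j i (hdeg _ _ he) (by simp [he₁, hp])
    have a3 := h1 e₂ p j (hdeg _ _ (hdeg _ _ he)) (by
      rw [he₂, mapDomain_swap_apply, Equiv.swap_apply_left, he₁, mapDomain_swap_apply,
        Equiv.swap_apply_left, hp])
    have h4 : e₂.mapDomain (Equiv.swap p j) = e.mapDomain (Equiv.swap i j) := by
      ext l
      rw [mapDomain_swap_apply, he₂, mapDomain_swap_apply, he₁, mapDomain_swap_apply,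
        mapDomain_swap_apply]
      congr 1
      simp only [Equiv.swap_apply_def]
      split_ifs <;> simp_all
    rw [h4] at a3
    have := I.add_mem (I.add_mem a1 a2) a3
    rwa [sub_add_sub_cancel, sub_add_sub_cancel] at this
  intro e he σ
  induction σ using Equiv.Perm.swap_induction_on with
  | one => simp [Finsupp.mapDomain_id]
  | swap_mul f x y hxy ih =>
    have h3 := I.add_mem ih (h2 _ x y hxy (hdeg e f he))
    rwa [sub_add_sub_cancel, ← Finsupp.mapDomain_comp, ← Equiv.Perm.coe_mul] at h3

/-- A subspace stable under the permutations of the variables. -/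
def IsPermStable {n : ℕ} (I : Submodule k (MvPolynomial (Fin n) k)) : Prop :=
  ∀ σ : Equiv.Perm (Fin n), ∀ f ∈ I, rename σ f ∈ I

/-- If the number of variables is large, a stable subspace of small codimension of `R_d` contains
all differences of monomials of the same type: `𝔖_n` acts trivially on the quotient. -/
theorem IsPermStable.containsPermDiffs {n d D : ℕ} (hn : d + D < n)
    {I : Submodule k (MvPolynomial (Fin n) k)} (hI : IsPermStable I) (hd : I ≤ degPart k n d)
    (hD : Module.finrank k (degPart k n d) ≤ Module.finrank k I + D) :
    ContainsPermDiffs d I := by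
  classical
  refine containsPermDiffs_of_swap (by omega) fun e j l he hj hl => ?_
  have hjl : j ≠ l := fun h => hj (h ▸ hl)
  -- The positions to which the exponent of `j` can be moved, with `l` held back. There are at least
  -- `n - d`, hence more than `D`, so the resulting monomials are linearly dependent modulo `I`.
  let B : Finset (Fin n) := insert j (e.supportᶜ.erase l)
  have hB : ∀ p ∈ B, p ≠ l ∧ (p = j ∨ e p = 0) := by
    intro p hp
    rcases Finset.mem_insert.mp hp with rfl | hp
    · exact ⟨hjl, Or.inl rfl⟩
    · obtain ⟨h1, h2⟩ := Finset.mem_erase.mp hp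
      exact ⟨h1, Or.inr (by simpa using h2)⟩
  have hBcard : D < B.card := by
    have h1 : l ∈ e.supportᶜ := by simpa using hl
    rw [Finset.card_insert_of_notMem (by simp [hj]), Finset.card_erase_of_mem h1,
      Finset.card_compl, Fintype.card_fin]
    have := card_support_le_degree e
    omega
  let f : Fin n → MvPolynomial (Fin n) k := fun p => monomial (e.mapDomain (Equiv.swap j p)) 1
  have hf : ∀ p, f p ∈ degPart k n d := fun p =>
    isHomogeneous_monomial _ (by rw [Finsupp.degree_mapDomain, he])
  let Q := degPart k n d ⧸ I.comap (degPart k n d).subtype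
  have hQ : Module.finrank k Q ≤ D := by
    have h1 := Submodule.finrank_quotient_add_finrank (I.comap (degPart k n d).subtype)
    rw [← Submodule.finrank_map_subtype_eq, Submodule.map_comap_subtype,
      inf_eq_right.mpr hd] at h1
    change Module.finrank k Q + _ = _ at h1
    omega
  obtain ⟨c, hc, p, hp⟩ : ∃ c : B → k, ∑ p : B, c p • f p ∈ I ∧ ∃ p, c p ≠ 0 := by
    have hdep : ¬ LinearIndependent k fun p : B =>
        (I.comap (degPart k n d).subtype).mkQ ⟨f p, hf p⟩ := fun hli => by
      have := hli.fintype_card_le_finrank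
      rw [Fintype.card_coe] at this
      exact absurd (this.trans hQ) (by omega)
    obtain ⟨c, hc, hp⟩ := Fintype.not_linearIndependent_iff.mp hdep
    refine ⟨c, ?_, hp⟩
    simp_rw [← map_smul, ← map_sum] at hc
    rw [Submodule.mkQ_apply, Submodule.Quotient.mk_eq_zero, Submodule.mem_comap] at hc
    simpa using hc
  have hzero : ∀ q r : Fin n, q ≠ r → (q = j ∨ e q = 0) → (r = j ∨ e r = 0) →
      e.mapDomain (Equiv.swap j r) q = 0 := by
    intro q r hqr h1 h2
    rw [mapDomain_swap_apply]
    by_cases hqj : q = j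
    · subst hqj
      rw [Equiv.swap_apply_left]
      exact h2.resolve_left hqr.symm
    · rw [Equiv.swap_apply_of_ne_of_ne hqj hqr]
      exact h1.resolve_left hqj
  have hfix : ∀ q q' r : Fin n, q ≠ r → q' ≠ r → (q = j ∨ e q = 0) → (q' = j ∨ e q' = 0) →
      (r = j ∨ e r = 0) → rename (Equiv.swap q q') (f r) = f r := by
    intro q q' r hq hq' h1 h2 h3
    rw [rename_monomial, mapDomain_swap_eq_self
      ((hzero q r hq h1 h3).trans (hzero q' r hq' h2 h3).symm)]
  have hmove : ∀ q q' : Fin n, (q = j ∨ e q = 0) → (q' = j ∨ e q' = 0) →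
      rename (Equiv.swap q q') (f q) = f q' := by
    intro q q' h1 h2
    rw [rename_monomial]
    congr 2
    ext i
    clear * - h1 h2
    simp only [mapDomain_swap_apply, Equiv.swap_apply_def]
    grind
  obtain ⟨hpl, hpj⟩ := hB p p.2
  -- The transposition of `p` and `l` fixes every `f q` of the relation with `q ≠ p`, since both
  -- variables are absent there. Subtracting the moved relation leaves a nonzero multiple of `f p -
  -- f l`.
  have h1 : f p - f l ∈ I := by
    have h2 := I.sub_mem hc (hI (Equiv.swap (p : Fin n) l) _ hc)
    rw [map_sum, ← Finset.sum_sub_distrib, Finset.sum_eq_single p] at h2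
    · rw [map_smul, hmove _ _ hpj (Or.inr hl), ← smul_sub] at h2
      exact (I.smul_mem_iff hp).mp h2
    · intro q _ hqp
      obtain ⟨hql, hqj⟩ := hB q q.2
      rw [map_smul, hfix _ _ _ (fun h => hqp (Subtype.ext h.symm)) hql.symm hpj (Or.inr hl) hqj,
        sub_self]
    · simp
  have hfj : f j = monomial e 1 := by
    simp only [f]
    rw [mapDomain_swap_eq_self rfl]
  rw [← hfj]
  by_cases hpj' : (p : Fin n) = j
  · rwa [hpj'] at h1
  · have h2 := hI (Equiv.swap (p : Fin n) j) _ h1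
    rwa [map_sub, hmove _ _ hpj (Or.inl rfl),
      hfix _ _ _ hpl hjl hpj (Or.inl rfl) (Or.inr hl)] at h2

/-! ### Symmetric ideals -/

theorem rename_mem_symSpan {n : ℕ} {F : Set (MvPolynomial (Fin n) k)} (σ : Equiv.Perm (Fin n))
    {f : MvPolynomial (Fin n) k} (hf : f ∈ F) : rename σ f ∈ symSpan k F :=
  Ideal.subset_span ⟨σ, f, hf, rfl⟩

theorem subset_symSpan {n : ℕ} (F : Set (MvPolynomial (Fin n) k)) :
    F ⊆ symSpan k F := fun f hf =>
  Ideal.subset_span ⟨1, f, hf, by rw [Equiv.Perm.coe_one, rename_id_apply]⟩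

theorem rename_mem_symSpan_of_mem {n : ℕ} {F : Set (MvPolynomial (Fin n) k)}
    (σ : Equiv.Perm (Fin n)) {f : MvPolynomial (Fin n) k} (hf : f ∈ symSpan k F) :
    rename σ f ∈ symSpan k F := by
  have h : symSpan k F ≤ (symSpan k F).comap (rename (R := k) σ) := by
    refine Ideal.span_le.mpr ?_
    rintro _ ⟨τ, g, hg, rfl⟩
    rw [SetLike.mem_coe, Ideal.mem_comap, rename_rename]
    exact rename_mem_symSpan (σ * τ) hg
  exact h hf

theorem symSpan_le {n : ℕ} {F : Set (MvPolynomial (Fin n) k)}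
    {I : Ideal (MvPolynomial (Fin n) k)}
    (h : ∀ (σ : Equiv.Perm (Fin n)), ∀ f ∈ F, rename σ f ∈ I) : symSpan k F ≤ I :=
  Ideal.span_le.mpr fun _ ⟨σ, f, hf, hg⟩ => hg ▸ h σ f hf

theorem isPermStable_idealDegPart_Phi {n d : ℕ} (V : Submodule k (MvPolynomial (Fin n) k)) :
    IsPermStable (idealDegPart k (Phi k n V) d) := fun σ _ hf =>
  ⟨rename_mem_symSpan_of_mem σ hf.1, IsHomogeneous.rename_isHomogeneous hf.2⟩

theorem Phi_le_Psi_alpha [CharZero k] {n d : ℕ} (h : d ≤ n)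
    {V : Submodule k (MvPolynomial (Fin n) k)} (hV : V ≤ degPart k n d) :
    Phi k n V ≤ Psi k n (alpha k n d V) := by
  refine symSpan_le fun σ f hf => (mem_Psi h).mpr ⟨?_, ?_⟩
  · exact IsHomogeneous.coeff_eq_zero_of_degree_lt (hV hf).rename_isHomogeneous
  · rw [typeCoeff_rename σ.injective, alpha_eq_map h hV]
    exact Submodule.mem_map_of_mem hf

/-- A form with type coordinates in `alpha k n d V` differs from some `v ∈ V` by a form with zero
coordinates, which lies in the ideal by `ContainsPermDiffs.mem`. -/
theorem idealDegPart_Phi [CharZero k] {n d : ℕ} (h : d ≤ n)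
    {V : Submodule k (MvPolynomial (Fin n) k)} (hV : V ≤ degPart k n d)
    (hP : ContainsPermDiffs d (idealDegPart k (Phi k n V) d)) :
    idealDegPart k (Phi k n V) d = symPreimage k n (alpha k n d V) := by
  refine le_antisymm ?_ fun f hf => ?_
  · rw [← idealDegPart_Psi h]
    exact inf_le_inf_right _ (Phi_le_Psi_alpha h hV)
  · have h1 : typeCoeff k n d f ∈ alpha k n d V := hf.1
    rw [alpha_eq_map h hV] at h1
    obtain ⟨v, hv, hvf⟩ := h1
    have h2 : f - v ∈ idealDegPart k (Phi k n V) d :=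
      hP.mem h (IsHomogeneous.sub hf.2 (hV hv)) (by rw [map_sub, hvf, sub_self])
    have h3 : v ∈ idealDegPart k (Phi k n V) d := ⟨subset_symSpan _ hv, hV hv⟩
    simpa using Submodule.add_mem _ h2 h3

theorem Psi_alpha_eq_Phi [CharZero k] {n d : ℕ} (h : d ≤ n)
    {V : Submodule k (MvPolynomial (Fin n) k)} (hV : V ≤ degPart k n d)
    (hP : ContainsPermDiffs d (idealDegPart k (Phi k n V) d))
    (hG : GeneratedInDegree k d (Psi k n (alpha k n d V))) :
    Psi k n (alpha k n d V) = Phi k n V := by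
  refine le_antisymm ?_ (Phi_le_Psi_alpha h hV)
  rw [hG, idealDegPart_Psi h, ← idealDegPart_Phi h hV hP]
  exact Ideal.span_le.mpr fun f hf => hf.1

/-- For many variables, the defining inequality of `Õ_n` says that `(V)_{𝔖_n}` contains the kernel
of the Reynolds operator and that symmetrization is injective on `V`. -/
theorem mem_setOTilde_iff [CharZero k] {n d r : ℕ} (h : d + numPart d < n)
    (hr : r ≤ numPart d) (V : Submodule k (MvPolynomial (Fin n) k)) :
    V ∈ setOTilde k n d r ↔ V ∈ grassR k n d r ∧
      ContainsPermDiffs d (idealDegPart k (Phi k n V) d) ∧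
      Module.finrank k (alpha k n d V) = r := by
  have hdn : d ≤ n := by omega
  refine and_congr_right fun hV => ⟨fun hle => ?_, fun ⟨hP, hr'⟩ => ?_⟩
  · have hP : ContainsPermDiffs d (idealDegPart k (Phi k n V) d) :=
      (isPermStable_idealDegPart_Phi V).containsPermDiffs (D := numPart d - r) (by omega)
        inf_le_right hle
    have h1 := finrank_symPreimage hdn (alpha k n d V)
    rw [← idealDegPart_Phi hdn hV.1 hP] at h1
    have : Module.Finite k V := finite_of_le_degPart hV.1
    -- The dimension formula together with the defining inequality gives at least `r`; this is the
    -- opposite bound.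
    have h2 : Module.finrank k (alpha k n d V) ≤ Module.finrank k V := by
      rw [alpha_eq_map hdn hV.1]
      exact Submodule.finrank_map_le _ _
    rw [hV.2] at h2
    exact ⟨hP, by omega⟩
  · have h1 := finrank_symPreimage hdn (alpha k n d V)
    rw [← idealDegPart_Phi hdn hV.1 hP] at h1
    omega

/-! ### Every parameter comes from a subspace -/

/-- With enough variables, the monomials of all types can be realized twice each in pairwise
disjoint sets of variables, leaving one variable unused. -/
theorem exists_disjoint_realization {n d : ℕ} (h : 2 * (numPart d * d) < n) :
    ∃ (A : Nat.Partition d × Bool → (Fin n →₀ ℕ)) (z : Fin n),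
      (∀ p, expParts (A p) = p.1.parts) ∧ (∀ p, A p z = 0) ∧
      ∀ p q i, A p i ≠ 0 → A q i ≠ 0 → p = q := by
  -- Each type and copy receives its own block of `d` variables; `none` is the spare variable `z`.
  have hcard : Fintype.card (Option ((Nat.Partition d × Bool) × Fin d)) ≤
      Fintype.card (Fin n) := by
    simp only [Fintype.card_option, Fintype.card_prod, Fintype.card_bool, Fintype.card_fin]
    unfold numPart at h
    nlinarith
  obtain ⟨b⟩ := Function.Embedding.nonempty_of_card_le hcard
  have hinj : ∀ p : Nat.Partition d × Bool, Function.Injective fun i : Fin d => b (some (p, i)) :=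
    fun p i j hij => by simpa using b.injective hij
  have hrange : ∀ (p : Nat.Partition d × Bool) (i : Fin n),
      ((partExp d p.1).mapDomain fun i : Fin d => b (some (p, i))) i ≠ 0 →
        ∃ j, b (some (p, j)) = i := by
    intro p i hi
    by_contra hne
    exact hi (Finsupp.mapDomain_of_notMem_range _ _ fun ⟨j, hj⟩ => hne ⟨j, hj⟩)
  refine ⟨fun p => (partExp d p.1).mapDomain fun i : Fin d => b (some (p, i)), b none,
    fun p => ?_, fun p => ?_, fun p q i hp hq => ?_⟩
  · rw [expParts_mapDomain (hinj p), expParts_partExp le_rfl]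
  · by_contra hne
    obtain ⟨j, hj⟩ := hrange p _ hne
    simpa using b.injective hj
  · obtain ⟨j, rfl⟩ := hrange p _ hp
    obtain ⟨j', hj'⟩ := hrange q _ hq
    have := b.injective hj'
    simp only [Option.some.injEq, Prod.mk.injEq] at this
    exact this.1.symm

/-- Exchanging a variable of one monomial `A p` with the spare `z` leaves all other terms alone, by
disjointness. Subtracting isolates a single difference of monomials of the type of `p`, and
permutations carry it to every difference needed in `containsPermDiffs_of_swap`. -/
theorem containsPermDiffs_of_disjoint_realization {n d : ℕ} (hn : d < n)
    {A : Nat.Partition d × Bool → (Fin n →₀ ℕ)} {z : Fin n}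
    (hA : ∀ p, expParts (A p) = p.1.parts) (hz : ∀ p, A p z = 0)
    (hdisj : ∀ p q i, A p i ≠ 0 → A q i ≠ 0 → p = q)
    {c : Nat.Partition d × Bool → k} (hc : ∀ l, c (l, true) ≠ 0)
    {I : Submodule k (MvPolynomial (Fin n) k)} (hI : IsPermStable I)
    (hmem : ∑ p, c p • monomial (A p) 1 ∈ I) : ContainsPermDiffs d I := by
  classical
  refine containsPermDiffs_of_swap hn fun e i j he hi hj => ?_
  set l := expPartition e he with hl
  set p : Nat.Partition d × Bool := (l, true) with hp
  obtain ⟨σ, hσ⟩ := exists_perm_of_expParts_eq (e := A p) (e' := e) (hA p)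
  -- Adjusts `σ` so that `z` goes to `j`; this is harmless because neither exchanged variable occurs
  -- in `A p`.
  set τ : Equiv.Perm (Fin n) := σ * Equiv.swap (σ.symm j) z with hτ
  have h0 : A p (σ.symm j) = 0 := by
    rw [← Finsupp.mapDomain_equiv_apply, ← hσ, hj]
  have hτA : (A p).mapDomain τ = e := by
    rw [hτ, Equiv.Perm.coe_mul, Finsupp.mapDomain_comp,
      mapDomain_swap_eq_self (h0.trans (hz p).symm), ← hσ]
  have hτz : τ z = j := by simp [hτ]
  set i' := τ.symm i with hi'
  have hAi' : A p i' ≠ 0 := by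
    rw [hi', ← Finsupp.mapDomain_equiv_apply, hτA]
    exact hi
  have h1 := I.sub_mem hmem (hI (Equiv.swap i' z) _ hmem)
  rw [map_sum, ← Finset.sum_sub_distrib, Finset.sum_eq_single p] at h1
  · rw [map_smul, rename_monomial, ← smul_sub] at h1
    have h2 := hI τ _ ((I.smul_mem_iff (hc l)).mp h1)
    rw [map_sub, rename_monomial, rename_monomial, hτA] at h2
    convert h2 using 3
    rw [← hτA, ← Finsupp.mapDomain_comp, ← Finsupp.mapDomain_comp, ← Equiv.Perm.coe_mul,
      ← Equiv.Perm.coe_mul]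
    congr 2
    rw [hi', ← hτz, Equiv.mul_swap_eq_swap_mul, Equiv.apply_symm_apply]
  · intro q _ hqp
    have hq : A q i' = 0 := by
      by_contra hne
      exact hqp (hdisj _ _ _ hne hAi')
    rw [map_smul, rename_monomial, mapDomain_swap_eq_self (hq.trans (hz q).symm), sub_self]
  · simp

/-- Every nonzero subspace of `k^{P(d)}` is the symmetrization of a subspace `V` of `R_d` of the
same dimension such that `(V)_{𝔖_n}` contains the kernel of the Reynolds operator. -/
theorem exists_alpha_eq [CharZero k] {n d : ℕ} (hd : d < n) (h : 2 * (numPart d * d) < n)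
    {U : Submodule k (Nat.Partition d → k)} (hU : U ≠ ⊥) :
    ∃ V ∈ grassR k n d (Module.finrank k U),
      ContainsPermDiffs d (idealDegPart k (Phi k n V) d) ∧ alpha k n d V = U := by
  classical
  obtain ⟨A, z, hA, hz, hdisj⟩ := exists_disjoint_realization h
  obtain ⟨c, hcU, hc0⟩ := U.exists_mem_ne_zero_of_ne_bot hU
  obtain ⟨l₀, hl₀⟩ := Function.ne_iff.mp hc0
  -- The coefficients of the two copies of type `l` add up to `u l`, so `s` is a section of
  -- `typeCoeff`. The copy marked `true` has coefficient `u l₀`; for `u = c` it is nonzero for every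
  -- type, even where `c l = 0`. This is why two copies are used.
  let t : Nat.Partition d × Bool → (Nat.Partition d → k) →ₗ[k] k := fun p =>
    if p.2 then LinearMap.proj (R := k) (φ := fun _ => k) l₀
    else LinearMap.proj (R := k) (φ := fun _ => k) p.1 - LinearMap.proj (R := k) (φ := fun _ => k) l₀
  let s : (Nat.Partition d → k) →ₗ[k] MvPolynomial (Fin n) k :=
    ∑ p, (t p).smulRight (monomial (A p) 1)
  have hs : ∀ u, s u = ∑ p, t p u • monomial (A p) 1 := fun u => by
    simp [s]
  have hts : ∀ u, typeCoeff k n d (s u) = u := by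
    intro u
    rw [hs, map_sum, Fintype.sum_prod_type]
    conv_rhs => rw [← Finset.univ_sum_single u]
    refine Finset.sum_congr rfl fun l _ => ?_
    simp only [map_smul, typeCoeff_monomial_of_expParts (hA _), Fintype.sum_bool]
    rw [← add_smul, ← Pi.single_smul]
    simp [t]
  have hsd : ∀ u, (s u).IsHomogeneous d := by
    intro u
    rw [hs]
    refine (degPart k n d).sum_mem fun p _ => (degPart k n d).smul_mem _
      (isHomogeneous_monomial _ ?_)
    rw [← sum_expParts, hA, p.1.parts_sum]
  have hVd : U.map s ≤ degPart k n d := by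
    rintro _ ⟨u, -, rfl⟩
    exact hsd u
  have hα : alpha k n d (U.map s) = U := by
    rw [alpha_eq_map hd.le hVd, ← Submodule.map_comp]
    convert Submodule.map_id U
    exact LinearMap.ext hts
  refine ⟨U.map s, ⟨hVd, ?_⟩, ?_, hα⟩
  · exact (Submodule.equivMapOfInjective s (Function.LeftInverse.injective hts) U).finrank_eq.symm
  · refine containsPermDiffs_of_disjoint_realization hd hA hz hdisj (c := fun p => t p c)
      (fun l => by simpa [t] using hl₀) (isPermStable_idealDegPart_Phi _) ?_
    rw [← hs]
    exact ⟨subset_symSpan _ (Submodule.mem_map_of_mem hcU), hsd c⟩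

/-! ### Changing the number of variables -/

theorem incl_injective {m n : ℕ} (h : m ≤ n) : Function.Injective (incl k h) :=
  rename_injective _ (Fin.castLE_injective h)

theorem piMap_mem_grassR {m n d r : ℕ} (h : m ≤ n) {V : Submodule k (MvPolynomial (Fin m) k)}
    (hV : V ∈ grassR k m d r) : piMap k h V ∈ grassR k n d r := by
  refine ⟨?_, ?_⟩
  · rintro _ ⟨f, hf, rfl⟩
    exact IsHomogeneous.rename_isHomogeneous (hV.1 hf)
  · rw [← hV.2]
    exact (Submodule.equivMapOfInjective (incl k h).toLinearMap (incl_injective h) V).finrank_eq.symm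

theorem alpha_piMap [CharZero k] {m n d r : ℕ} (hd : d ≤ m) (h : m ≤ n)
    {V : Submodule k (MvPolynomial (Fin m) k)} (hV : V ∈ grassR k m d r) :
    alpha k n d (piMap k h V) = alpha k m d V := by
  rw [alpha_eq_map hd hV.1, alpha_eq_map (hd.trans h) (piMap_mem_grassR h hV).1, piMap,
    ← Submodule.map_comp]
  congr 1
  exact LinearMap.ext fun f => typeCoeff_rename (Fin.castLE_injective h) f

/-- A permutation of the smaller set of variables extends to the larger one. -/
theorem exists_perm_extend {m n : ℕ} (h : m ≤ n) (σ : Equiv.Perm (Fin m)) :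
    ∃ τ : Equiv.Perm (Fin n), ∀ i, τ (Fin.castLE h i) = Fin.castLE h (σ i) := by
  refine ⟨σ.extendDomain (Equiv.ofInjective _ (Fin.castLE_injective h)), fun i => ?_⟩
  exact Equiv.Perm.extendDomain_apply_image σ (Equiv.ofInjective _ (Fin.castLE_injective h)) i

theorem incl_mem_symSpan {m n : ℕ} (h : m ≤ n) {F : Set (MvPolynomial (Fin m) k)}
    {f : MvPolynomial (Fin m) k} (hf : f ∈ symSpan k F) :
    incl k h f ∈ symSpan k (incl k h '' F) := by
  have hle : symSpan k F ≤ (symSpan k (incl k h '' F)).comap (incl k h) := by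
    refine symSpan_le fun σ f hf => ?_
    obtain ⟨τ, hτ⟩ := exists_perm_extend h σ
    rw [Ideal.mem_comap, incl, rename_rename, show Fin.castLE h ∘ σ = τ ∘ Fin.castLE h from
      funext fun i => (hτ i).symm, ← rename_rename]
    exact rename_mem_symSpan τ ⟨f, hf, rfl⟩
  exact hle hf

theorem eta_Phi {m n : ℕ} (h : m ≤ n) (V : Submodule k (MvPolynomial (Fin m) k)) :
    eta k h (Phi k m V) = Phi k n (piMap k h V) := by
  refine le_antisymm (symSpan_le fun σ f hf => ?_) (symSpan_le fun σ f hf => ?_)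
  · obtain ⟨g, hg, rfl⟩ := hf
    have := rename_mem_symSpan_of_mem σ (incl_mem_symSpan h hg)
    exact this
  · obtain ⟨g, hg, rfl⟩ := hf
    exact rename_mem_symSpan σ ⟨g, subset_symSpan _ hg, rfl⟩

/-- A small set of variables can be moved into the first `m` variables. -/
theorem exists_perm_mem_range_castLE {m n : ℕ} (h : m ≤ n) (s : Finset (Fin n))
    (hs : s.card ≤ m) :
    ∃ σ : Equiv.Perm (Fin n), ∀ i ∈ s, σ i ∈ Set.range (Fin.castLE h) := by
  obtain ⟨t, hst, -, ht⟩ := Finset.exists_subsuperset_card_eq (Finset.subset_univ s) hs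
    (by simpa using h)
  let e : {i // i ∈ t} ≃ {i // i ∈ Set.range (Fin.castLE h)} :=
    (Finset.equivFinOfCardEq ht).trans (Equiv.ofInjective _ (Fin.castLE_injective h))
  classical
  exact ⟨e.extendSubtype, fun i hi => e.extendSubtype_mem i (hst hi)⟩

/-- A monomial of degree `d` and one further variable involve at most `d + 1 ≤ m` variables, so a
permutation brings the difference into the smaller ring. -/
theorem ContainsPermDiffs.piMap {m n d : ℕ} (hd : d < m) (h : m ≤ n)
    {V : Submodule k (MvPolynomial (Fin m) k)}
    (hV : ContainsPermDiffs d (idealDegPart k (Phi k m V) d)) :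
    ContainsPermDiffs d (idealDegPart k (Phi k n (piMap k h V)) d) := by
  classical
  refine containsPermDiffs_of_swap (hd.trans_le h) fun e i j he hi hj => ?_
  obtain ⟨σ, hσ⟩ := exists_perm_mem_range_castLE h (insert j e.support)
    ((Finset.card_insert_le _ _).trans (by have := card_support_le_degree e; omega))
  obtain ⟨i', hi'⟩ := hσ i (by simp [hi])
  obtain ⟨j', hj'⟩ := hσ j (by simp)
  set g := (e.mapDomain σ).comapDomain (Fin.castLE h) (Fin.castLE_injective h).injOn with hg
  have hge : g.mapDomain (Fin.castLE h) = e.mapDomain σ := by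
    refine Finsupp.mapDomain_comapDomain _ (Fin.castLE_injective h) _ fun i hi => ?_
    have h1 : σ.symm i ∈ e.support := by
      simpa [Finsupp.mapDomain_equiv_apply] using hi
    simpa using hσ _ (Finset.mem_insert_of_mem h1)
  have hgd : g.degree = d := by
    rw [← Finsupp.degree_mapDomain (Fin.castLE h), hge, Finsupp.degree_mapDomain, he]
  have h1 := (hV g hgd (Equiv.swap i' j')).1
  have h2 : rename σ.symm _ ∈ (Phi k n (SymIdeal.piMap k h V)).restrictScalars k :=
    rename_mem_symSpan_of_mem σ.symm (incl_mem_symSpan h h1)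
  refine ⟨?_, IsHomogeneous.sub (isHomogeneous_monomial _ he)
    (isHomogeneous_monomial _ (by rw [Finsupp.degree_mapDomain, he]))⟩
  have hσe : (e.mapDomain σ).mapDomain σ.symm = e := by
    rw [← Finsupp.mapDomain_comp, Equiv.symm_comp_self, Finsupp.mapDomain_id]
  have h3 : σ.symm ∘ Fin.castLE h ∘ Equiv.swap i' j' =
      Equiv.swap i j ∘ σ.symm ∘ Fin.castLE h := by
    funext x
    simp only [Function.comp_apply]
    have hi2 : i = σ.symm (Fin.castLE h i') := by rw [hi', Equiv.symm_apply_apply]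
    have hj2 : j = σ.symm (Fin.castLE h j') := by rw [hj', Equiv.symm_apply_apply]
    rw [hi2, hj2]
    exact (Function.Injective.map_swap
      (σ.symm.injective.comp (Fin.castLE_injective h)) i' j' x)
  rwa [incl, rename_rename, map_sub, rename_monomial, rename_monomial, Finsupp.mapDomain_comp, hge,
    hσe, ← Finsupp.mapDomain_comp, Function.comp_assoc, h3, Finsupp.mapDomain_comp,
    Finsupp.mapDomain_comp (f := Fin.castLE h), hge, hσe] at h2

/-! ### Existence of parameter sets -/

/-- Linearly independent vectors have a nonzero maximal minor. -/
theorem exists_minor_ne_zero {ι : Type*} [Fintype ι] {r : ℕ} {v : Fin r → ι → k}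
    (hv : LinearIndependent k v) :
    ∃ c : Fin r → ι, (Matrix.of fun i j : Fin r => v i (c j)).det ≠ 0 := by
  classical
  have hrank : (Matrix.of v).rank = r := by
    have h := LinearIndependent.rank_matrix (M := Matrix.of v) hv
    rwa [Fintype.card_fin] at h
  rw [Matrix.rank_eq_finrank_span_cols] at hrank
  obtain ⟨f, hf, -, hli⟩ := Submodule.exists_fun_fin_finrank_span_eq k (Set.range (Matrix.of v).col)
  choose c hc using hf
  let e : Fin r ≃ Fin _ := finCongr hrank.symm
  refine ⟨c ∘ e, ?_⟩
  rw [← isUnit_iff_ne_zero, ← Matrix.isUnit_iff_isUnit_det,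
    ← Matrix.linearIndependent_cols_iff_isUnit]
  have hcol : (Matrix.of fun i j => v i ((c ∘ e) j)).col = f ∘ e := by
    funext j
    rw [Function.comp_apply, ← hc]
    rfl
  rw [hcol]
  exact hli.comp e e.injective

/-- The `r`-dimensional subspaces not contained in a hyperplane `∑ a_i = 0` form a Zariski open
set. -/
theorem isZariskiOpen_sum_ne_zero {ι : Type*} [Fintype ι] (r : ℕ) :
    IsZariskiOpen k r
      {U : Submodule k (ι → k) | Module.finrank k U = r ∧ ∃ u ∈ U, ∑ i, u i ≠ 0} := by
  classical
  -- Let `w` be the vector of coordinate sums of the basis vectors. These linear forms in the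
  -- Plücker coordinates are the entries of the Cramer vectors of `w`, for all choices `c` of
  -- columns.
  refine ⟨fun U hU => hU.1, {p | ∃ (c : Fin r → ι) (j : Fin r),
    p = ∑ i, X (Function.update c j i)}, ?_, fun U b => ?_⟩
  · rintro _ ⟨c, j, rfl⟩
    exact ⟨1, IsHomogeneous.sum _ _ _ fun i _ => isHomogeneous_X k _⟩
  · have hfr : Module.finrank k U = r := by
      rw [Module.finrank_eq_card_basis b, Fintype.card_fin]
    set v : Fin r → ι → k := fun a => (b a : ι → k) with hv
    have hcramer : ∀ (c : Fin r → ι) (j : Fin r),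
        eval (plucker k v) (∑ i, X (Function.update c j i)) =
          (Matrix.of fun a a' : Fin r => v a (c a')).cramer (∑ i, fun a => v a i) j := by
      intro c j
      rw [map_sum, map_sum, Finset.sum_apply]
      refine Finset.sum_congr rfl fun i _ => ?_
      rw [eval_X, Matrix.cramer_apply, plucker]
      congr 1
      ext a a'
      rw [Matrix.updateCol_apply, Matrix.of_apply, Matrix.of_apply, Function.update_apply]
      split_ifs <;> rfl
    have hw : (∃ u ∈ U, ∑ i, u i ≠ 0) ↔ (∑ i, fun a => v a i) ≠ 0 := by
      constructor
      · rintro ⟨u, hu, hne⟩ h0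
        apply hne
        have hu' := congrArg Subtype.val (b.sum_repr ⟨u, hu⟩)
        rw [Submodule.coe_sum] at hu'
        simp only [Submodule.coe_smul] at hu'
        rw [← hu']
        simp only [Finset.sum_apply, Pi.smul_apply, smul_eq_mul]
        rw [Finset.sum_comm]
        refine Finset.sum_eq_zero fun a _ => ?_
        have h1 := congrFun h0 a
        rw [Finset.sum_apply, Pi.zero_apply] at h1
        rw [← Finset.mul_sum, h1, mul_zero]
      · intro hne
        obtain ⟨a, ha⟩ := Function.ne_iff.mp hne
        rw [Finset.sum_apply, Pi.zero_apply] at ha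
        exact ⟨v a, (b a).2, ha⟩
    rw [Set.mem_ofPred_eq, hw]
    constructor
    · rintro ⟨-, hne⟩
      have hli : LinearIndependent k v :=
        b.linearIndependent.map' U.subtype U.ker_subtype
      obtain ⟨c, hc⟩ := exists_minor_ne_zero hli
      -- For a nonzero minor, the matrix applied to the Cramer vector is the determinant times `w`,
      -- so some entry is nonzero.
      have h1 := Matrix.mulVec_cramer (Matrix.of fun a a' : Fin r => v a (c a'))
        (∑ i, fun a => v a i)
      have h2 : (Matrix.of fun a a' : Fin r => v a (c a')).cramer (∑ i, fun a => v a i) ≠ 0 := by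
        intro h0
        rw [h0, Matrix.mulVec_zero] at h1
        exact (smul_ne_zero hc hne) h1.symm
      obtain ⟨j, hj⟩ := Function.ne_iff.mp h2
      exact ⟨_, ⟨c, j, rfl⟩, by rw [hcramer]; exact hj⟩
    · rintro ⟨_, ⟨c, j, rfl⟩, hne⟩
      refine ⟨hfr, fun h0 => hne ?_⟩
      rw [hcramer, h0, map_zero, Pi.zero_apply]

/-! ### Monomials of degree `d + 1` modulo the differences in degree `d` -/

section NextDegree

variable {n d : ℕ} {J : Ideal (MvPolynomial (Fin n) k)}

/-- In an ideal containing the kernel of the Reynolds operator in degree `d`, one factor of a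
monomial of degree `d + 1` can be kept while the others are permuted. -/
theorem monomial_sub_mem_of_ne_zero (hJ : ContainsPermDiffs d (J.restrictScalars k))
    {b : Fin n →₀ ℕ} (hb : b.degree = d + 1) {i : Fin n} (hi : b i ≠ 0)
    (σ : Equiv.Perm (Fin n)) :
    (monomial b 1 - monomial ((b - Finsupp.single i 1).mapDomain σ + Finsupp.single i 1) 1 :
      MvPolynomial (Fin n) k) ∈ J := by
  have hle : Finsupp.single i 1 ≤ b := by
    rw [Finsupp.single_le_iff]; omega
  have hdec : b - Finsupp.single i 1 + Finsupp.single i 1 = b := tsub_add_cancel_of_le hle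
  have hdeg : (b - Finsupp.single i 1).degree = d := by
    have := congrArg Finsupp.degree hdec
    rw [map_add, Finsupp.degree_single, hb] at this
    omega
  have h := J.mul_mem_right (monomial (Finsupp.single i 1) 1) (hJ _ hdeg σ)
  rwa [sub_mul, monomial_mul, monomial_mul, hdec, one_mul] at h

/-- Keep one factor `x_j` and exchange `i` and `j` in the rest: the exponent of `x_j` becomes one
more than that of `x_i` was. Repeating this concentrates the monomial in one variable; `t` counts
the missing exponent. -/
theorem exists_monomial_sub_single_mem (hJ : ContainsPermDiffs d (J.restrictScalars k)) (t : ℕ) :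
    ∀ (b : Fin n →₀ ℕ) (i : Fin n), b.degree = d + 1 → b i + t = d + 1 →
      ∃ j, (monomial b 1 - monomial (Finsupp.single j (d + 1)) 1 : MvPolynomial (Fin n) k) ∈ J := by
  induction t with
  | zero =>
    intro b i hb hi
    refine ⟨i, ?_⟩
    have h : b = Finsupp.single i (d + 1) := by
      have hle : Finsupp.single i (d + 1) ≤ b := by rw [Finsupp.single_le_iff]; omega
      have hdec := tsub_add_cancel_of_le hle
      have h1 := congrArg Finsupp.degree hdec
      rw [map_add, Finsupp.degree_single, hb] at h1
      rw [← hdec, (Finsupp.degree_eq_zero_iff _).mp (by omega : (b - _).degree = 0), zero_add]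
    rw [← h, sub_self]
    exact J.zero_mem
  | succ t ih =>
    intro b i hb hi
    obtain ⟨j, hji, hj⟩ : ∃ j, j ≠ i ∧ b j ≠ 0 := by
      by_contra hne
      push Not at hne
      have h1 : b.degree = b i := by
        rw [Finsupp.degree_eq_sum]
        exact Finset.sum_eq_single i (fun j _ hj => hne j hj) (by simp)
      omega
    have h1 := monomial_sub_mem_of_ne_zero hJ hb hj (Equiv.swap i j)
    set b' := (b - Finsupp.single j 1).mapDomain (Equiv.swap i j) + Finsupp.single j 1 with hb'
    have hb'd : b'.degree = d + 1 := by
      have hle : Finsupp.single j 1 ≤ b := by rw [Finsupp.single_le_iff]; omega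
      rw [hb', map_add, Finsupp.degree_mapDomain, ← map_add, tsub_add_cancel_of_le hle, hb]
    have hb'j : b' j = b i + 1 := by
      rw [hb', Finsupp.add_apply, mapDomain_swap_apply, Equiv.swap_apply_right]
      simp [hji]
    obtain ⟨j', hj'⟩ := ih b' j hb'd (by omega)
    refine ⟨j', ?_⟩
    simpa using J.add_mem h1 hj'

/-- With a third variable `r`, the chain is `x_p^{d+1}`, `x_r^d x_p`, `x_r^d x_q`, `x_q^{d+1}`. If
there is none, `d < n` forces `d = 1`, and `x_p x_q` links the two squares. -/
theorem single_sub_single_mem (hd : 0 < d) (hn : d < n)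
    (hJ : ContainsPermDiffs d (J.restrictScalars k)) (p q : Fin n) :
    (monomial (Finsupp.single p (d + 1)) 1 - monomial (Finsupp.single q (d + 1)) 1 :
      MvPolynomial (Fin n) k) ∈ J := by
  classical
  rcases eq_or_ne p q with rfl | hpq
  · rw [sub_self]
    exact J.zero_mem
  have h1 : ∀ p r : Fin n, (monomial (Finsupp.single p (d + 1)) 1 -
      monomial (Finsupp.single r d + Finsupp.single p 1) 1 : MvPolynomial (Fin n) k) ∈ J := by
    intro p r
    have h := monomial_sub_mem_of_ne_zero hJ (Finsupp.degree_single p (d + 1)) (i := p) (by simp)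
      (Equiv.swap p r)
    rwa [← Finsupp.single_tsub, Nat.add_sub_cancel, Finsupp.mapDomain_single,
      Equiv.swap_apply_left] at h
  by_cases hr : ∃ r, r ≠ p ∧ r ≠ q
  · obtain ⟨r, hrp, hrq⟩ := hr
    have h2 := monomial_sub_mem_of_ne_zero hJ (b := Finsupp.single r d + Finsupp.single p 1)
      (by simp) (i := r) (by simp; omega) (Equiv.swap p q)
    have h3 : Finsupp.single r d + Finsupp.single p 1 - Finsupp.single r 1 =
        Finsupp.single r (d - 1) + Finsupp.single p 1 := by
      rw [← tsub_add_eq_add_tsub (by rw [Finsupp.single_le_iff]; simp; omega),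
        Finsupp.single_tsub]
    rw [h3, Finsupp.mapDomain_add, Finsupp.mapDomain_single, Finsupp.mapDomain_single,
      Equiv.swap_apply_of_ne_of_ne hrp hrq, Equiv.swap_apply_left, add_right_comm,
      ← Finsupp.single_add, Nat.sub_add_cancel hd] at h2
    have := J.sub_mem (J.add_mem (h1 p r) h2) (h1 q r)
    simpa using this
  · push Not at hr
    have hd1 : d = 1 := by
      have hsub : (Finset.univ : Finset (Fin n)) ⊆ {p, q} := fun r _ => by
        by_cases h : r = p
        · simp [h]
        · simp [hr r h]
      have h := Finset.card_le_card hsub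
      rw [Finset.card_univ, Fintype.card_fin, Finset.card_pair hpq] at h
      omega
    have h2 := J.sub_mem (h1 p q) (h1 q p)
    rw [show Finsupp.single q d + Finsupp.single p 1 = Finsupp.single p d + Finsupp.single q 1 by
      rw [hd1, add_comm]] at h2
    simpa using h2

/-- Modulo an ideal containing the kernel of the Reynolds operator in degree `d`, all monomials of
degree `d + 1` agree. -/
theorem monomial_sub_monomial_mem (hd : 0 < d) (hn : d < n)
    (hJ : ContainsPermDiffs d (J.restrictScalars k)) {b b' : Fin n →₀ ℕ}
    (hb : b.degree = d + 1) (hb' : b'.degree = d + 1) :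
    (monomial b 1 - monomial b' 1 : MvPolynomial (Fin n) k) ∈ J := by
  have key : ∀ b : Fin n →₀ ℕ, b.degree = d + 1 → ∃ j,
      (monomial b 1 - monomial (Finsupp.single j (d + 1)) 1 : MvPolynomial (Fin n) k) ∈ J := by
    intro b hb
    let i : Fin n := ⟨0, by omega⟩
    have hle : b i ≤ b.degree := Finsupp.le_degree _ _
    exact exists_monomial_sub_single_mem hJ (d + 1 - b i) b i hb (by omega)
  obtain ⟨j, hj⟩ := key b hb
  obtain ⟨j', hj'⟩ := key b' hb'
  have := J.sub_mem (J.add_mem hj (single_sub_single_mem hd hn hJ j j')) hj'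
  simpa using this

/-- If moreover the ideal contains a form of degree `d` with nonzero coefficient sum, then it
contains all monomials of higher degree. -/
theorem monomial_mem_of_lt_degree (hd : 0 < d) (hn : d < n)
    (hJ : ContainsPermDiffs d (J.restrictScalars k)) {u : Nat.Partition d → k}
    (hu : ∑ l, u l ≠ 0) (huJ : ∑ l, u l • partMonomial k n l ∈ J) {b : Fin n →₀ ℕ}
    (hb : d < b.degree) (c : k) : monomial b c ∈ J := by
  have i₀ : Fin n := ⟨0, by omega⟩
  have h1 : ∀ b : Fin n →₀ ℕ, b.degree = d + 1 → (monomial b 1 : MvPolynomial (Fin n) k) ∈ J := by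
    intro b hb
    have h2 := J.mul_mem_right (monomial (Finsupp.single i₀ 1) 1) huJ
    have h3 : ∑ l, u l • (monomial b 1 - monomial (partExp n l + Finsupp.single i₀ 1) 1 :
        MvPolynomial (Fin n) k) ∈ J.restrictScalars k :=
      Submodule.sum_mem _ fun l _ => Submodule.smul_mem _ _
        (monomial_sub_monomial_mem hd hn hJ hb
          (by rw [map_add, degree_partExp hn.le, Finsupp.degree_single]))
    -- Multiplying the given form by a variable and replacing each of its monomials by `x^b` leaves
    -- the coefficient sum times `x^b`.
    have h4 : (∑ l, u l) • monomial b (1 : k) ∈ J.restrictScalars k := by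
      have h5 := Submodule.add_mem _ h3 (show _ ∈ J.restrictScalars k from h2)
      rw [Finset.sum_mul, ← Finset.sum_add_distrib] at h5
      rw [Finset.sum_smul]
      convert h5 using 2 with l
      rw [partMonomial_eq, smul_mul_assoc, monomial_mul, one_mul, ← smul_add, sub_add_cancel]
    exact (Submodule.smul_mem_iff _ hu).mp h4
  obtain ⟨b', hb'b, hb'⟩ := Finsupp.exists_le_degree_eq b (d + 1) hb
  have h2 := J.mul_mem_left (monomial (b - b') c) (h1 b' hb')
  rwa [monomial_mul, tsub_add_cancel_of_le hb'b, mul_one] at h2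

end NextDegree

/-- The preimage of `U` in degree `d` contains all differences and a form with coefficient sum
nonzero, so it generates every monomial of degree above `d`. What remains of `f` is its component of
degree `d`. -/
theorem generatedInDegree_Psi [CharZero k] {n d : ℕ} (hd : 0 < d) (hn : d < n)
    {U : Submodule k (Nat.Partition d → k)} {u : Nat.Partition d → k} (huU : u ∈ U)
    (hu : ∑ l, u l ≠ 0) : GeneratedInDegree k d (Psi k n U) := by
  classical
  refine le_antisymm (fun f hf => ?_) (Ideal.span_le.mpr fun f hf => hf.1)
  rw [idealDegPart_Psi hn.le]
  set J := Ideal.span (symPreimage k n U : Set (MvPolynomial (Fin n) k))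
  have hJ : ContainsPermDiffs d (J.restrictScalars k) := fun e he σ =>
    Ideal.subset_span ⟨by
      rw [SetLike.mem_coe, Submodule.mem_comap, map_sub, ← rename_monomial,
        typeCoeff_rename σ.injective, sub_self]
      exact U.zero_mem,
      IsHomogeneous.sub (isHomogeneous_monomial _ he)
        (isHomogeneous_monomial _ (by rw [Finsupp.degree_mapDomain, he]))⟩
  have huJ : ∑ l, u l • partMonomial k n l ∈ J := by
    refine Ideal.subset_span ⟨?_, ?_⟩
    · rw [SetLike.mem_coe, Submodule.mem_comap, map_sum]
      convert huU
      conv_rhs => rw [← Finset.univ_sum_single u]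
      refine Finset.sum_congr rfl fun l _ => ?_
      rw [map_smul, partMonomial_eq, typeCoeff_monomial_of_expParts (expParts_partExp hn.le l),
        ← Pi.single_smul, smul_eq_mul, mul_one]
    · exact (degPart k n d).sum_mem fun l _ => (degPart k n d).smul_mem _
        (isHomogeneous_partMonomial hn.le l)
  obtain ⟨hlow, hfU⟩ := (mem_Psi hn.le).mp hf
  rw [← sub_add_cancel f (homogeneousComponent d f)]
  refine J.add_mem ?_ (Ideal.subset_span ⟨?_, homogeneousComponent_isHomogeneous d f⟩)
  · rw [← support_sum_monomial_coeff (f - _)]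
    refine J.sum_mem fun e he => monomial_mem_of_lt_degree hd hn hJ hu huJ ?_ _
    by_contra hle
    refine mem_support_iff.mp he ?_
    rw [coeff_sub, coeff_homogeneousComponent]
    split_ifs with h
    · exact sub_self _
    · rw [hlow e (by omega), sub_zero]
  · rwa [SetLike.mem_coe, Submodule.mem_comap, typeCoeff_homogeneousComponent]

theorem exists_isParameterSet [CharZero k] {d r : ℕ} (hd : 0 < d) (hr : 0 < r)
    (hrP : r ≤ numPart d) : ∃ G, IsParameterSet k d r G := by
  classical
  refine ⟨_, ?_, isZariskiOpen_sum_ne_zero r,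
    fun n hn U ⟨_, u, huU, hu⟩ => generatedInDegree_Psi hd hn huU hu⟩
  -- A coordinate subspace is a member: a standard basis vector, available as `r > 0`, has
  -- coordinate sum `1`.
  let g : Fin r ↪ Nat.Partition d :=
    (Fin.castLEEmb hrP).trans (Fintype.equivFin (Nat.Partition d)).symm.toEmbedding
  have hli : LinearIndependent k fun i : Fin r => (Pi.single (g i) 1 : Nat.Partition d → k) := by
    have h := (Pi.basisFun k (Nat.Partition d)).linearIndependent.comp g g.injective
    convert h using 1
    funext i
    simp
  refine ⟨Submodule.span k (Set.range fun i : Fin r => (Pi.single (g i) 1 : Nat.Partition d → k)),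
    ?_, Pi.single (g ⟨0, hr⟩) 1, Submodule.subset_span ⟨_, rfl⟩, ?_⟩
  · rw [finrank_span_eq_card hli, Fintype.card_fin]
  · simp

/-! ### General symmetric ideals -/

section General

variable [CharZero k] {d r : ℕ} {G : Set (Submodule k (Nat.Partition d → k))}

/-- This removes the case distinction in `setO`: for `r = numPart d` the only subspace of dimension
`r` is the whole space, and it lies in `G` since `G` is nonempty. -/
theorem mem_setO_iff (hr : r ≤ numPart d) (hG : IsParameterSet k d r G) {n : ℕ}
    (hn : d + numPart d < n) (V : Submodule k (MvPolynomial (Fin n) k)) :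
    V ∈ setO k n d r G ↔ V ∈ grassR k n d r ∧
      ContainsPermDiffs d (idealDegPart k (Phi k n V) d) ∧ alpha k n d V ∈ G := by
  rw [setO, Set.mem_ofPred_eq, mem_setOTilde_iff hn hr, and_assoc, and_assoc]
  refine and_congr_right fun hV => and_congr_right fun hP => ⟨fun ⟨hα, hlt⟩ => ?_, fun hα =>
    ⟨hG.isOpen.1 _ hα, fun _ => hα⟩⟩
  rcases hr.lt_or_eq with h | h
  · exact hlt h
  · have htop : ∀ U : Submodule k (Nat.Partition d → k), Module.finrank k U = r → U = ⊤ :=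
      fun U hU => Submodule.eq_top_of_finrank_eq (by
        rw [hU, h, Module.finrank_fintype_fun_eq_card, numPart])
    obtain ⟨U, hU⟩ := hG.nonempty
    rw [htop _ hα, ← htop U (hG.isOpen.1 U hU)]
    exact hU

theorem Psi_alpha_of_mem_setO (hr : r ≤ numPart d) (hG : IsParameterSet k d r G) {n : ℕ}
    (hn : d + numPart d < n) {V : Submodule k (MvPolynomial (Fin n) k)}
    (hV : V ∈ setO k n d r G) : Psi k n (alpha k n d V) = Phi k n V := by
  obtain ⟨hV1, hP, hα⟩ := (mem_setO_iff hr hG hn V).mp hV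
  exact Psi_alpha_eq_Phi (by omega) hV1.1 hP (hG.generated n (by omega) _ hα)

theorem exists_mem_setO_alpha_eq (hr0 : 0 < r) (hr : r ≤ numPart d) (hG : IsParameterSet k d r G)
    {n : ℕ} (hn : d + numPart d < n) (hn' : 2 * (numPart d * d) < n)
    {U : Submodule k (Nat.Partition d → k)} (hU : U ∈ G) :
    ∃ V ∈ setO k n d r G, alpha k n d V = U := by
  have hfr := hG.isOpen.1 U hU
  have hne : U ≠ ⊥ := by
    rintro rfl
    rw [finrank_bot] at hfr
    omega
  obtain ⟨V, hV, hP, hα⟩ := exists_alpha_eq (n := n) (by omega) hn' hne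
  rw [hfr] at hV
  exact ⟨V, (mem_setO_iff hr hG hn V).mpr ⟨hV, hP, by rwa [hα]⟩, hα⟩

theorem bijOn_Psi (hr0 : 0 < r) (hr : r ≤ numPart d) (hG : IsParameterSet k d r G)
    {n : ℕ} (hn : d + numPart d < n) (hn' : 2 * (numPart d * d) < n) :
    Set.BijOn (Psi k n) G (generalIdeals k n d r G) := by
  refine ⟨fun U hU => ?_, (Psi_injective (by omega)).injOn, ?_⟩
  · obtain ⟨V, hV, rfl⟩ := exists_mem_setO_alpha_eq hr0 hr hG hn hn' hU
    exact ⟨V, hV, (Psi_alpha_of_mem_setO hr hG hn hV).symm⟩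
  · rintro _ ⟨V, hV, rfl⟩
    exact ⟨_, ((mem_setO_iff hr hG hn V).mp hV).2.2, Psi_alpha_of_mem_setO hr hG hn hV⟩

theorem mapsTo_piMap (hr : r ≤ numPart d) (hG : IsParameterSet k d r G) {m n : ℕ}
    (hm : d + numPart d < m) (h : m ≤ n) :
    Set.MapsTo (piMap k h) (setO k m d r G) (setO k n d r G) := by
  intro V hV
  obtain ⟨hV1, hP, hα⟩ := (mem_setO_iff hr hG hm V).mp hV
  refine (mem_setO_iff hr hG (hm.trans_le h) _).mpr
    ⟨piMap_mem_grassR h hV1, hP.piMap (by omega) h, ?_⟩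
  rwa [alpha_piMap (by omega) h hV1]

/-- Choose `V` over `U` in `m` variables and follow it: `eta` of `Phi` is `Phi` of `piMap`, and
`piMap` does not change `alpha`. -/
theorem eta_Psi (hr0 : 0 < r) (hr : r ≤ numPart d) (hG : IsParameterSet k d r G) {m n : ℕ}
    (hm : d + numPart d < m) (hm' : 2 * (numPart d * d) < m) (h : m ≤ n)
    {U : Submodule k (Nat.Partition d → k)} (hU : U ∈ G) :
    eta k h (Psi k m U) = Psi k n U := by
  obtain ⟨V, hV, rfl⟩ := exists_mem_setO_alpha_eq hr0 hr hG hm hm' hU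
  rw [Psi_alpha_of_mem_setO hr hG hm hV, eta_Phi,
    ← Psi_alpha_of_mem_setO hr hG (hm.trans_le h) (mapsTo_piMap hr hG hm h hV),
    alpha_piMap (by omega) h hV.1.1]

theorem bijOn_eta (hr0 : 0 < r) (hr : r ≤ numPart d) (hG : IsParameterSet k d r G) {m n : ℕ}
    (hm : d + numPart d < m) (hm' : 2 * (numPart d * d) < m) (h : m ≤ n) :
    Set.BijOn (eta k h) (generalIdeals k m d r G) (generalIdeals k n d r G) := by
  have h1 := bijOn_Psi hr0 hr hG hm hm'
  have h2 := bijOn_Psi hr0 hr hG (hm.trans_le h) (hm'.trans_le h)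
  have h3 : Set.EqOn (Psi k n) (eta k h ∘ Psi k m) G := fun U hU =>
    (eta_Psi hr0 hr hG hm hm' h hU).symm
  exact h1.image_eq ▸ (Set.bijOn_comp_iff h1.injOn).mp (h2.congr h3)

end General

end SymIdeal

end

theorem theoremC (d : ℕ) (hd : 0 < d) :
    ∃ m₀ : ℕ, ∀ (k : Type*) [Field k] [CharZero k] (r : ℕ), 0 < r → r ≤ SymIdeal.numPart d →
      (∃ G : Set (Submodule k (Nat.Partition d → k)), SymIdeal.IsParameterSet k d r G) ∧
      ∀ G : Set (Submodule k (Nat.Partition d → k)), SymIdeal.IsParameterSet k d r G →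
        ∀ m : ℕ, m₀ ≤ m → ∀ (n : ℕ) (hmn : m ≤ n),
          -- `η_{m,n}` restricts to a bijection between the sets of general symmetric ideals
          Set.BijOn (SymIdeal.eta k hmn)
            (SymIdeal.generalIdeals k m d r G) (SymIdeal.generalIdeals k n d r G) ∧
          -- `π_{m,n}(O_m) ⊆ O_n`
          Set.MapsTo (SymIdeal.piMap k hmn)
            (SymIdeal.setO k m d r G) (SymIdeal.setO k n d r G) ∧
          -- `α_m` and `α_n` map to `G`, and the left triangle commutes
          Set.MapsTo (SymIdeal.alpha k m d) (SymIdeal.setO k m d r G) G ∧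
          Set.MapsTo (SymIdeal.alpha k n d) (SymIdeal.setO k n d r G) G ∧
          (∀ V ∈ SymIdeal.setO k m d r G,
            SymIdeal.alpha k n d (SymIdeal.piMap k hmn V) = SymIdeal.alpha k m d V) ∧
          -- the trapezoid on top commutes
          (∀ V ∈ SymIdeal.setO k m d r G,
            SymIdeal.eta k hmn (SymIdeal.Phi k m V) =
              SymIdeal.Phi k n (SymIdeal.piMap k hmn V)) ∧
          -- the middle triangle and the outer triangle commute
          (∀ V ∈ SymIdeal.setO k m d r G,
            SymIdeal.Psi k m (SymIdeal.alpha k m d V) = SymIdeal.Phi k m V) ∧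
          (∀ V ∈ SymIdeal.setO k n d r G,
            SymIdeal.Psi k n (SymIdeal.alpha k n d V) = SymIdeal.Phi k n V) ∧
          -- `Ψ_m` and `Ψ_n` are bijections, and the right triangle commutes
          Set.BijOn (SymIdeal.Psi k m) G (SymIdeal.generalIdeals k m d r G) ∧
          Set.BijOn (SymIdeal.Psi k n) G (SymIdeal.generalIdeals k n d r G) ∧
          (∀ U ∈ G, SymIdeal.eta k hmn (SymIdeal.Psi k m U) = SymIdeal.Psi k n U) := by

  -- The first two summands serve the codimension argument, the product serves the disjoint blocks,
  -- and the final `1` makes both inequalities strict.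
  refine ⟨d + SymIdeal.numPart d + 2 * (SymIdeal.numPart d * d) + 1, fun k _ _ r hr0 hr =>
    ⟨SymIdeal.exists_isParameterSet hd hr0 hr, fun G hG m hm₀ n hmn => ?_⟩⟩
  have hm : d + SymIdeal.numPart d < m := by omega
  have hm' : 2 * (SymIdeal.numPart d * d) < m := by omega
  exact ⟨SymIdeal.bijOn_eta hr0 hr hG hm hm' hmn, SymIdeal.mapsTo_piMap hr hG hm hmn,
    fun V hV => ((SymIdeal.mem_setO_iff hr hG hm V).mp hV).2.2,
    fun V hV => ((SymIdeal.mem_setO_iff hr hG (hm.trans_le hmn) V).mp hV).2.2,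
    fun V hV => SymIdeal.alpha_piMap (by omega) hmn hV.1.1,
    fun V _ => SymIdeal.eta_Phi hmn V,
    fun V hV => SymIdeal.Psi_alpha_of_mem_setO hr hG hm hV,
    fun V hV => SymIdeal.Psi_alpha_of_mem_setO hr hG (hm.trans_le hmn) hV,
    SymIdeal.bijOn_Psi hr0 hr hG hm hm',
    SymIdeal.bijOn_Psi hr0 hr hG (hm.trans_le hmn) (hm'.trans_le hmn),
    fun U hU => SymIdeal.eta_Psi hr0 hr hG hm hm' hmn hU⟩
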